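/- Let $\mathbb{D}=\{z\in\mathbb{C}:|z|<1\}$ be the Poincaré disk with metric $4|dz|^2/(1-|z|^2)^2$ and Laplacian $\Delta=\frac14(1-|z|^2)^2(\partial_x^2+\partial_y^2)$, and let $\Gamma$ be a co-compact Fuchsian group, that is, a discrete group of Möbius transformations of $\mathbb{D}$ (acting also on $\mathbb{S}^1=\partial\mathbb{D}$) for which some compact subset of $\mathbb{D}$ meets every orbit. Let $s=\frac12+it$ with $t\in\mathbb{R}$, and let $f:\mathbb{D}\to\mathbb{C}$ be a $\mathcal{C}^2$ function with $\Delta f=-s(1-s)f$ on $\mathbb{D}$ and $f\circ\gamma=f$ for all $\gamma\in\Gamma$. Let $(\mathbb{S}^1,T,\{I_k\}_{k=1}^q)$ be a piecewise $\Gamma$-Möbius Markov transformation: $T:\mathbb{S}^1\to\mathbb{S}^1$ is surjective, $\{I_k\}$ is a finite partition of $\mathbb{S}^1$ into intervals (nonempty connected sets) such that each $T(I_k)$ is a union of adjacent intervals $I_l$, on each $I_k$ the map $T$ coincides with an element $\gamma_k\in\Gamma$, and some iterate of $T$ is uniformly expanding ($|(T^n)'|\ge c$ on $\mathbb{S}^1$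 for some $n$ and some constant $c>1$, where $T'=\gamma_k'$ on $I_k$). For a piecewise $\mathcal{C}^1$ function $\psi=\oplus_k\psi_k\in\bigoplus_{k=1}^q\mathcal{C}^1(\bar I_k)$, let $$\mathcal{L}_s\psi=\bigoplus_{l=1}^q\phi_l,\qquad \phi_l(\xi)=\sum_{k:\ I_l\subset T(I_k)}\frac{\psi_k(\gamma_k^{-1}\xi)}{|\gamma_k'(\gamma_k^{-1}\xi)|^{s}}\qquad(\xi\in\bar I_l),$$ the Ruelle transfer operator with potential $-s\ln|T'|$, which maps $\bigoplus_k\mathcal{C}^1(\bar I_k)$ to itself. The Helgason distribution $\mathcal{D}_{f,s}$ of $f$ acts on such $\psi$ by $$\langle\mathcal{D}_{f,s},\psi\rangle=\lim_{r\to+\infty}\frac1{c(s)}\int_0^{2\pi}\psi(e^{i\theta})\,e^{-sr}\Big(\frac{\partial F}{\partial r}+sF\Big)(r,\theta)\,\sinh r\,d\theta,$$ where $\psi=\psi_k$ on $I_k$, $F(r,\theta)=f\big(\tanh(\tfrac r2)e^{i\theta}\big)$, and $c(s)=2\sqrt\pi\,\Gamma(s+\frac12)/\Gamma(s)$ (here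 $\Gamma(\cdot)$ is Euler's Gamma function) is the nonzero normalizing constant for which $\langle\mathcal{D}_{f,s},\mathbf 1\rangle=f(0)$. Then these limits exist for every $\psi\in\bigoplus_k\mathcal{C}^1(\bar I_k)$, so that $\mathcal{D}_{f,s}$ is a well-defined linear functional on $\bigoplus_k\mathcal{C}^1(\bar I_k)$, and it is fixed by the dual of $\mathcal{L}_s$: $$\mathcal{L}_s^*\mathcal{D}_{f,s}=\mathcal{D}_{f,s},\qquad\text{i.e.}\qquad \langle\mathcal{D}_{f,s},\mathcal{L}_s\psi\rangle=\langle\mathcal{D}_{f,s},\psi\rangle\quad\text{for all }\psi\in\bigoplus_{k=1}^q\mathcal{C}^1(\bar I_k).$$ -/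

import Mathlib

open Set Filter Topology
open scoped Manifold ContDiff InnerProductSpace ComplexConjugate

attribute [local instance] finrank_real_complex_fact'

noncomputable section

namespace Hyperbolic

/-- The group `SU(1,1)` of complex matrices with rows `(a, b)` and `(conj b, conj a)` and
`|a|² - |b|² = 1`, which act on the disk as `z ↦ (a z + b) / (conj b z + conj a)`.
These are all orientation-preserving isometries of the Poincaré disk; `g` and `-g` induce the same
isometry. -/
def SU11 : Subgroup (Matrix.SpecialLinearGroup (Fin 2) ℂ) where
  carrier := {g | g 1 1 = conj (g 0 0) ∧ g 1 0 = conj (g 0 1)}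
  one_mem' := by simp
  mul_mem' := by
    rintro g h ⟨hg1, hg2⟩ ⟨hh1, hh2⟩
    simp only [mem_ofPred_eq, Matrix.SpecialLinearGroup.coe_mul, Matrix.mul_apply,
      Fin.sum_univ_two, map_add, map_mul, hg1, hg2, hh1, hh2, Complex.conj_conj]
    constructor <;> ring
  inv_mem' := by
    rintro g ⟨hg1, hg2⟩
    simp [Matrix.SpecialLinearGroup.coe_inv, Matrix.adjugate_fin_two, hg1, hg2]

/-- The Möbius transformation of the matrix `g`. -/
def mobius (g : SU11) (z : ℂ) : ℂ :=
  (g.1 0 0 * z + g.1 0 1) / (g.1 1 0 * z + g.1 1 1)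

lemma normSq_sub (g : SU11) : Complex.normSq (g.1 0 0) - Complex.normSq (g.1 0 1) = 1 := by
  have hd := g.1.det_coe
  rw [Matrix.det_fin_two, g.2.1, g.2.2, Complex.mul_conj, Complex.mul_conj] at hd
  exact_mod_cast hd

lemma det_eq (g : SU11) : g.1 0 0 * g.1 1 1 - g.1 0 1 * g.1 1 0 = 1 := by
  have hd := g.1.det_coe
  rwa [Matrix.det_fin_two] at hd

lemma num_eq (g : SU11) (z : Circle) :
    g.1 0 0 * (z : ℂ) + g.1 0 1 = z * conj (g.1 1 0 * (z : ℂ) + g.1 1 1) := by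
  have hz : (z : ℂ) * conj (z : ℂ) = 1 := by
    rw [Complex.mul_conj]; simp
  rw [g.2.1, g.2.2]
  simp only [map_add, map_mul, Complex.conj_conj]
  linear_combination -(g.1 0 1) * hz

lemma denom_ne_zero (g : SU11) (z : Circle) : g.1 1 0 * (z : ℂ) + g.1 1 1 ≠ 0 := by
  intro h
  have h2 := num_eq g z
  rw [h, map_zero, mul_zero] at h2
  have := det_eq g
  have h3 : (g.1 0 0 * g.1 1 1 - g.1 0 1 * g.1 1 0) = 0 := by
    linear_combination g.1 0 0 * h - g.1 1 0 * h2
  rw [h3] at this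
  exact zero_ne_one this

lemma norm_mobius (g : SU11) (z : Circle) : ‖mobius g z‖ = 1 := by
  unfold mobius
  rw [num_eq, norm_div, norm_mul, RCLike.norm_conj, Circle.norm_coe, one_mul]
  exact div_self (norm_ne_zero_iff.mpr (denom_ne_zero g z))

/-- The action of `SU(1,1)` on the circle at infinity by Möbius transformations. -/
instance instMulActionCircle : MulAction SU11 Circle where
  smul g z := ⟨mobius g z, by simpa [Submonoid.unitSphere] using norm_mobius g z⟩
  one_smul z := by
    apply Circle.ext
    change mobius 1 z = z
    simp [mobius]
  mul_smul g h z := by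
    apply Circle.ext
    change mobius (g * h) z = mobius g (mobius h z)
    have h1 := denom_ne_zero h z
    have h2 := denom_ne_zero (g * h) z
    simp only [Subgroup.coe_mul, Matrix.SpecialLinearGroup.coe_mul, Matrix.mul_apply,
      Fin.sum_univ_two] at h2
    simp only [mobius, Subgroup.coe_mul, Matrix.SpecialLinearGroup.coe_mul, Matrix.mul_apply,
      Fin.sum_univ_two]
    have h3 : g.1 1 0 * ((h.1 0 0 * (z : ℂ) + h.1 0 1) / (h.1 1 0 * z + h.1 1 1)) + g.1 1 1 ≠ 0 := by
      intro h0
      apply h2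
      rw [← mul_div_assoc, div_add' _ _ _ h1, div_eq_zero_iff] at h0
      linear_combination h0.resolve_right h1
    rw [div_eq_div_iff h2 h3]
    field_simp
    ring

lemma coe_smul (g : SU11) (z : Circle) : ((g • z : Circle) : ℂ) = mobius g z := rfl

/-- The derivative modulus `|g'(ξ)|` at a boundary point `ξ`. -/
def boundaryDeriv (g : SU11) (ξ : Circle) : ℝ := ‖deriv (mobius g) (ξ : ℂ)‖

lemma boundaryDeriv_eq (g : SU11) (z : Circle) :
    boundaryDeriv g z = (Complex.normSq (g.1 1 0 * (z : ℂ) + g.1 1 1))⁻¹ := by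
  have h1 := denom_ne_zero g z
  have hd : HasDerivAt (mobius g)
      ((g.1 0 0 * (g.1 1 0 * (z : ℂ) + g.1 1 1) - (g.1 0 0 * z + g.1 0 1) * g.1 1 0)
        / (g.1 1 0 * (z : ℂ) + g.1 1 1) ^ 2) z := by
    have ha : HasDerivAt (fun w : ℂ => g.1 0 0 * w + g.1 0 1) (g.1 0 0) z := by
      simpa using ((hasDerivAt_id (z : ℂ)).const_mul (g.1 0 0)).add_const (g.1 0 1)
    have hb : HasDerivAt (fun w : ℂ => g.1 1 0 * w + g.1 1 1) (g.1 1 0) z := by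
      simpa using ((hasDerivAt_id (z : ℂ)).const_mul (g.1 1 0)).add_const (g.1 1 1)
    exact ha.fun_div hb h1
  have e : g.1 0 0 * (g.1 1 0 * (z : ℂ) + g.1 1 1) - (g.1 0 0 * z + g.1 0 1) * g.1 1 0 = 1 := by
    linear_combination det_eq g
  rw [boundaryDeriv, hd.deriv, e, norm_div, norm_pow, norm_one, Complex.normSq_eq_norm_sq, one_div]

lemma boundaryDeriv_pos (g : SU11) (z : Circle) : 0 < boundaryDeriv g z := by
  rw [boundaryDeriv_eq]
  exact inv_pos.mpr (Complex.normSq_pos.mpr (denom_ne_zero g z))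

lemma contMDiff_coe : ContMDiff (𝓡 1) 𝓘(ℝ, ℂ) 1 (fun z : Circle => (z : ℂ)) :=
  contMDiff_coe_sphere (E := ℂ) (n := 1)

lemma contMDiff_affine (a b : ℂ) :
    ContMDiff (𝓡 1) 𝓘(ℝ, ℂ) 1 (fun z : Circle => a * (z : ℂ) + b) := by
  have h : ContDiff ℝ 1 (fun w : ℂ => a * w + b) := by fun_prop
  exact h.contMDiff.comp contMDiff_coe

lemma contMDiff_smul (g : SU11) : ContMDiff (𝓡 1) (𝓡 1) 1 (fun z : Circle => g • z) := by
  have h : ContMDiff (𝓡 1) 𝓘(ℝ, ℂ) 1 (fun z : Circle => mobius g z) := by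
    intro z
    have hp : ContMDiffAt (𝓡 1) 𝓘(ℝ, ℂ) 1 (fun z : Circle => (z : ℂ)) z := contMDiff_coe z
    have h1 : ContDiffAt ℝ 1 (fun w : ℂ => g.1 0 0 * w + g.1 0 1) (z : ℂ) := by fun_prop
    have h2 : ContDiffAt ℝ 1 (fun w : ℂ => g.1 1 0 * w + g.1 1 1) (z : ℂ) := by fun_prop
    have hm : ContDiffAt ℝ 1 (mobius g) (z : ℂ) :=
      (h1.mul (h2.inv (denom_ne_zero g z))).congr_of_eventuallyEq
        (Eventually.of_forall fun w => div_eq_mul_inv _ _)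
    exact hm.contMDiffAt.comp z hp
  exact h.codRestrict_sphere (n := 1) (fun z => by simpa using norm_mobius g z)

lemma contMDiff_boundaryDeriv_cpow (g : SU11) (s : ℂ) :
    ContMDiff (𝓡 1) 𝓘(ℝ, ℂ) 1 (fun z : Circle => ((boundaryDeriv g z : ℝ) : ℂ) ^ s) := by
  intro z
  have hp : ContMDiffAt (𝓡 1) 𝓘(ℝ, ℂ) 1 (fun z : Circle => (z : ℂ)) z := contMDiff_coe z
  have hm : ContDiffAt ℝ 1 (fun w : ℂ => Complex.exp
      (((Real.log (‖g.1 1 0 * w + g.1 1 1‖ ^ 2)⁻¹ : ℝ) : ℂ) * s)) (z : ℂ) := by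
    have hn : ‖g.1 1 0 * (z : ℂ) + g.1 1 1‖ ^ 2 ≠ 0 :=
      pow_ne_zero 2 (norm_ne_zero_iff.mpr (denom_ne_zero g z))
    have h1 : ContDiffAt ℝ 1 (fun w : ℂ => (‖g.1 1 0 * w + g.1 1 1‖ ^ 2)) (z : ℂ) :=
      (ContDiffAt.norm_sq ℝ (by fun_prop))
    have h2 := (h1.inv hn).log (inv_ne_zero hn)
    have h3 : ContDiffAt ℝ 1 (fun w : ℂ =>
        ((Real.log (‖g.1 1 0 * w + g.1 1 1‖ ^ 2)⁻¹ : ℝ) : ℂ)) (z : ℂ) :=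
      Complex.ofRealCLM.contDiff.contDiffAt.comp (z : ℂ) h2
    exact (h3.mul contDiffAt_const).cexp
  have h4 := hm.contMDiffAt.comp z hp
  refine h4.congr_of_eventuallyEq (Eventually.of_forall fun w => ?_)
  have hw := boundaryDeriv_pos g w
  change ((boundaryDeriv g w : ℝ) : ℂ) ^ s = Complex.exp
    (((Real.log (‖g.1 1 0 * (w : ℂ) + g.1 1 1‖ ^ 2)⁻¹ : ℝ) : ℂ) * s)
  rw [← Complex.normSq_eq_norm_sq, ← boundaryDeriv_eq, Complex.ofReal_log hw.le,
    Complex.cpow_def_of_ne_zero (by exact_mod_cast hw.ne')]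

/-- `Γ` is a co-compact Fuchsian group: a discrete group of Möbius transformations of the disk for
which some compact part of the disk meets every orbit. -/
structure IsCocompactFuchsian (Γ : Subgroup SU11) : Prop where
  discrete : DiscreteTopology Γ
  cocompact : ∃ K : Set ℂ, IsCompact K ∧ K ⊆ Metric.ball 0 1 ∧
    ∀ z ∈ Metric.ball (0 : ℂ) 1, ∃ g ∈ Γ, mobius g z ∈ K

/-- A `Γ`-automorphic eigenfunction, `Δ f = -s (1 - s) f`, of the hyperbolic Laplacian
`Δ = ¼ (1 - |z|²)² (∂²/∂x² + ∂²/∂y²)` on the unit disk. Values of `f` off the open disk are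
irrelevant. -/
structure IsAutomorphicEigenfunction (Γ : Subgroup SU11) (s : ℂ) (f : ℂ → ℂ) : Prop where
  contDiffOn : ContDiffOn ℝ 2 f (Metric.ball 0 1)
  eigen : ∀ z ∈ Metric.ball (0 : ℂ) 1,
    (((1 - ‖z‖ ^ 2) ^ 2 / 4 : ℝ) : ℂ) * Laplacian.laplacian f z = -s * (1 - s) * f z
  automorphic : ∀ g ∈ Γ, ∀ z ∈ Metric.ball (0 : ℂ) 1, f (mobius g z) = f z

/-- The constant `c(s)` which normalizes the Helgason distribution so that its value on the
constant function `1` is `f 0`. -/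
def normalizingConstant (s : ℂ) : ℂ :=
  2 * (√Real.pi : ℝ) * Complex.Gamma (s + 1 / 2) / Complex.Gamma s

/-- The point at hyperbolic distance `r` from the origin on the ray towards `exp (i θ)`. -/
def polar (r θ : ℝ) : ℂ := (Real.tanh (r / 2) : ℝ) * (Circle.exp θ : ℂ)

/-- `c(s)⁻¹ ∫ u e^{-s r} (∂f/∂n + s f) |dz|` over the hyperbolic circle of radius `r` about the
origin, where `∂f/∂n` is the derivative along the outward hyperbolic unit normal, `|dz| = sinh r dθ`
is hyperbolic arc length, and `u` is extended inside the disk as a function constant on rays. -/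
def helgasonIntegral (s : ℂ) (f : ℂ → ℂ) (u : Circle → ℂ) (r : ℝ) : ℂ :=
  (normalizingConstant s)⁻¹ * ∫ θ in (0 : ℝ)..(2 * Real.pi),
    u (Circle.exp θ) * (Complex.exp (-s * r) *
      (deriv (fun ρ : ℝ => f (polar ρ θ)) r + s * f (polar r θ)) * (Real.sinh r : ℝ))

/-- A piecewise `Γ`-Möbius Markov transformation of the circle. Intervals are nonempty connected
sets, so each `T (I k)`, being connected, is a union of *adjacent* intervals `I l` as soon as it is
a union of intervals `I l`. -/
structure MarkovMap (Γ : Subgroup SU11) where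
  T : Circle → Circle
  surjective : Function.Surjective T
  q : ℕ
  I : Fin q → Set Circle
  isConnected : ∀ k, IsConnected (I k)
  disjoint : Pairwise fun k l => Disjoint (I k) (I l)
  iUnion_eq : ⋃ k, I k = univ
  markov : ∀ k, ∃ S : Set (Fin q), T '' I k = ⋃ l ∈ S, I l
  γ : Fin q → SU11
  γ_mem : ∀ k, γ k ∈ Γ
  T_eq : ∀ k, ∀ ξ ∈ I k, T ξ = γ k • ξ
  /-- Some iterate `T^n` satisfies `|(T^n)'| ≥ c` for a constant `c > 1`: here `w` is the itinerary
  of `ξ`, and the product is `|(T^n)'(ξ)|` by the chain rule. -/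
  expanding : ∃ n : ℕ, ∃ c : ℝ, 1 < c ∧ ∀ (ξ : Circle) (w : ℕ → Fin q),
    (∀ j, T^[j] ξ ∈ I (w j)) →
      c ≤ ∏ j ∈ Finset.range n, boundaryDeriv (γ (w j)) (T^[j] ξ)

namespace MarkovMap

variable {Γ : Subgroup SU11} (M : MarkovMap Γ)

/-- The space `⨁ C¹(closure (I k))` of piecewise `C¹` functions. The `k`-th component is
represented by a function on the circle of which only the values on `closure (I k)` matter. -/
def PiecewiseC1 : Submodule ℂ (Fin M.q → Circle → ℂ) where
  carrier := {ψ | ∀ k, ContMDiffOn (𝓡 1) 𝓘(ℝ, ℂ) 1 (ψ k) (closure (M.I k))}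
  add_mem' := fun ha hb k => (ha k).add (hb k)
  zero_mem' := fun _ => contMDiffOn_const
  smul_mem' := by
    intro c ψ h k
    have h1 : ContDiff ℝ 1 (fun w : ℂ => c * w) := by fun_prop
    exact h1.contMDiff.comp_contMDiffOn (h k)

/-- The function on the circle which equals the `k`-th component of `ψ` on `I k`. -/
def glue (ψ : Fin M.q → Circle → ℂ) (ξ : Circle) : ℂ := ∑ k, (M.I k).indicator (ψ k) ξ

open Classical in
/-- The components of `L_s ψ`: on the closure of `I l` it is the sum, over all `k` with
`I l ⊆ T (I k)`, of `(ψ k / |T'|^s) ∘ (T|I k)⁻¹`, where `T` is `γ k` on `I k`. -/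
def transferFun (s : ℂ) (ψ : Fin M.q → Circle → ℂ) (l : Fin M.q) (ξ : Circle) : ℂ :=
  ∑ k with M.I l ⊆ M.T '' M.I k,
    ψ k ((M.γ k)⁻¹ • ξ) / ((boundaryDeriv (M.γ k) ((M.γ k)⁻¹ • ξ) : ℝ) : ℂ) ^ s

lemma transferFun_mem (s : ℂ) {ψ : Fin M.q → Circle → ℂ} (hψ : ψ ∈ M.PiecewiseC1) :
    M.transferFun s ψ ∈ M.PiecewiseC1 := by
  classical
  intro l
  have key : ∀ k, M.I l ⊆ M.T '' M.I k → ContMDiffOn (𝓡 1) 𝓘(ℝ, ℂ) 1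
      (fun ξ => ψ k ((M.γ k)⁻¹ • ξ) / ((boundaryDeriv (M.γ k) ((M.γ k)⁻¹ • ξ) : ℝ) : ℂ) ^ s)
      (closure (M.I l)) := by
    intro k hk
    have hg := contMDiff_smul (M.γ k)⁻¹
    have hmaps : MapsTo (fun ξ : Circle => (M.γ k)⁻¹ • ξ) (closure (M.I l)) (closure (M.I k)) := by
      apply MapsTo.closure _ hg.continuous
      intro ξ hξ
      obtain ⟨η, hη, rfl⟩ := hk hξ
      simpa [M.T_eq k η hη] using hη
    have h1 := (hψ k).comp hg.contMDiffOn hmaps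
    have h2 := (contMDiff_boundaryDeriv_cpow (M.γ k) (-s)).comp hg
    have h3 : ContDiff ℝ 1 (fun w : ℂ × ℂ => w.1 * w.2) := by fun_prop
    have h4 := h3.contMDiff.comp_contMDiffOn (h1.prodMk_space h2.contMDiffOn)
    refine h4.congr fun ξ _ => ?_
    simp [Complex.cpow_neg, div_eq_mul_inv]
  exact contMDiffOn_finsetSum fun k hk => key k (Finset.mem_filter.mp hk).2

/-- The Ruelle transfer operator `L_s`, with potential `-s log |T'|`, on piecewise `C¹`
functions. -/
def transferOperator (s : ℂ) : M.PiecewiseC1 →ₗ[ℂ] M.PiecewiseC1 where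
  toFun ψ := ⟨M.transferFun s ψ, M.transferFun_mem s ψ.2⟩
  map_add' ψ φ := by
    ext l ξ
    simp [transferFun, add_div, Finset.sum_add_distrib]
  map_smul' c ψ := by
    ext l ξ
    simp [transferFun, mul_div_assoc, Finset.mul_sum]

/-- `D` is the Helgason distribution `D_{f,s}` on piecewise `C¹` functions: the limits of the
integrals over large hyperbolic circles exist, and `D` is given by them. -/
def IsHelgasonDistribution (s : ℂ) (f : ℂ → ℂ) (D : Module.Dual ℂ M.PiecewiseC1) : Prop :=
  ∀ ψ : M.PiecewiseC1,
    Tendsto (fun r : ℝ => helgasonIntegral s f (M.glue ψ) r) atTop (𝓝 (D ψ))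

end MarkovMap

end Hyperbolic

end

noncomputable section

namespace Hyperbolic

/-! ### Second derivatives along curves and the Laplacian -/

/-! By the Markov property, the transfer operator only pushes pieces forward: the function glued
from `L_s ψ` is the sum over `k` of the piece of `ψ` on `I k`, moved by `γ k` as a density of order
`s` (`MarkovMap.glue_transferFun`). By additivity, everything reduces to one isometry `g` and one
function `u` that is C¹ on an arc. The claim is then that the Helgason integral of `f ∘ g⁻¹` against
the pushed `u` and that of `f` against `u` differ by o(1) as `r → ∞` (`isEquivariant`). For `g` in
`Γ`, `f ∘ g⁻¹ = f` and the two limits agree.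

Co-compactness bounds `f` and its hyperbolic gradient. The class of bounded eigenfunctions with
bounded gradient is invariant under all of SU(1,1), so equivariance can be checked on generators,
which need not lie in `Γ`.

Convergence (`exists_tendsto_integral_radialPart`): with `F` denoting `f` in polar coordinates, the
eigenvalue equation gives d/dr [e^{-sr} (F_r + sF) sinh r] = e^{-sr} (s e^{-r} F - F_θθ / sinh r).
Against a C¹ weight on an arc, one integration by parts replaces F_θθ by F_θ = O(sinh r). Since Re s
= 1/2, the arc integral has r-derivative O(e^{-r/2}), which is integrable.

Equivariance: by the Cartan decomposition, rotations and translations suffice. Rotations give an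
exact equality. For translations, the transported arc integral is differentiated in the length `τ`.
The Killing field is cos θ ∂_r - coth r sin θ ∂_θ, and the flow at infinity adds sin θ ∂_θ and the
weight (1 - s) cos θ. By the eigenvalue equation only terms with a factor coth r - 1 or 1 / sinh² r
survive (`radialPart_flow`). Integration by parts again gives O(e^{-r/2}), uniformly for `τ` in [0,
t], and the mean value inequality in `τ` concludes (`tendsto_integral_flow_sub`). -/

lemma hasDerivAt_fderiv_comp {E F : Type*} [NormedAddCommGroup E] [NormedSpace ℝ E]
    [NormedAddCommGroup F] [NormedSpace ℝ F] {f : E → F} {U : Set E} (hU : IsOpen U)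
    (hf : ContDiffOn ℝ 2 f U) {c c₁ : ℝ → E} {d c₂ : E} {t : ℝ} (hc : HasDerivAt c d t)
    (hc₁ : HasDerivAt c₁ c₂ t) (ht : c t ∈ U) :
    HasDerivAt (fun x => fderiv ℝ f (c x) (c₁ x))
      (fderiv ℝ (fderiv ℝ f) (c t) d (c₁ t) + fderiv ℝ f (c t) c₂) t := by
  have h1 : ContDiffOn ℝ 1 (fderiv ℝ f) U := hf.fderiv_of_isOpen hU (by norm_num)
  have h2 : HasFDerivAt (fderiv ℝ f) (fderiv ℝ (fderiv ℝ f) (c t)) (c t) :=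
    ((h1.contDiffAt (hU.mem_nhds ht)).differentiableAt (by norm_num)).hasFDerivAt
  exact (h2.comp_hasDerivAt t hc).clm_apply hc₁

lemma hasDerivAt_comp_of_contDiffOn {E F : Type*} [NormedAddCommGroup E] [NormedSpace ℝ E]
    [NormedAddCommGroup F] [NormedSpace ℝ F] {f : E → F} {U : Set E} (hU : IsOpen U)
    (hf : ContDiffOn ℝ 2 f U) {c : ℝ → E} {d : E} {t : ℝ} (hc : HasDerivAt c d t)
    (ht : c t ∈ U) : HasDerivAt (fun x => f (c x)) (fderiv ℝ f (c t) d) t := by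
  have h2 : HasFDerivAt f (fderiv ℝ f (c t)) (c t) :=
    ((hf.contDiffAt (hU.mem_nhds ht)).differentiableAt (by norm_num)).hasFDerivAt
  exact h2.comp_hasDerivAt t hc

lemma laplacian_eq_fderiv_fderiv (f : ℂ → ℂ) (z : ℂ) :
    Laplacian.laplacian f z = fderiv ℝ (fderiv ℝ f) z 1 1
      + fderiv ℝ (fderiv ℝ f) z Complex.I Complex.I := by
  rw [InnerProductSpace.laplacian_eq_iteratedFDeriv_complexPlane]
  simp [iteratedFDeriv_two_apply]

/-- The vectors `w` and `I * w` are the frame `1`, `I` rotated and scaled by `‖w‖`; the cross terms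
cancel in the sum. This gives both the conformal covariance of the Laplacian and its form in polar
coordinates. -/
lemma bilinear_conformal (B : ℂ →L[ℝ] ℂ →L[ℝ] ℂ) (w : ℂ) :
    B w w + B (Complex.I * w) (Complex.I * w)
      = ((‖w‖ ^ 2 : ℝ) : ℂ) * (B 1 1 + B Complex.I Complex.I) := by
  obtain ⟨x, y, hw⟩ : ∃ x y : ℝ, w = x • (1 : ℂ) + y • Complex.I :=
    ⟨w.re, w.im, by apply Complex.ext <;> simp⟩
  have hw' : Complex.I * w = (-y) • (1 : ℂ) + x • Complex.I := by
    rw [hw]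
    apply Complex.ext <;> simp
  have hn : ‖w‖ ^ 2 = x * x + y * y := by
    rw [← Complex.normSq_eq_norm_sq, Complex.normSq_apply, hw]
    simp
  rw [hn, hw', hw]
  simp only [map_add, map_smul, _root_.add_apply, _root_.smul_apply]
  simp only [Complex.real_smul]
  push_cast
  ring

/-! ### Möbius transformations of the disk -/

lemma mem_ball_iff_normSq {z : ℂ} : z ∈ Metric.ball (0 : ℂ) 1 ↔ Complex.normSq z < 1 := by
  rw [mem_ball_zero_iff, Complex.normSq_eq_norm_sq, sq_lt_one_iff₀ (norm_nonneg z)]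

/-- The matrices of SU(1,1) preserve the Hermitian form |w|² - |z|², evaluated here at (z, 1). -/
lemma normSq_denom_sub_normSq_num (g : SU11) (z : ℂ) :
    Complex.normSq (g.1 1 0 * z + g.1 1 1) - Complex.normSq (g.1 0 0 * z + g.1 0 1)
      = 1 - Complex.normSq z := by
  have h := normSq_sub g
  rw [g.2.1, g.2.2]
  simp only [Complex.normSq_apply, Complex.add_re, Complex.add_im, Complex.mul_re, Complex.mul_im,
    Complex.conj_re, Complex.conj_im] at h ⊢
  linear_combination (1 - z.re * z.re - z.im * z.im) * h

lemma denom_ne_zero_of_mem_ball (g : SU11) {z : ℂ} (hz : z ∈ Metric.ball (0 : ℂ) 1) :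
    g.1 1 0 * z + g.1 1 1 ≠ 0 := by
  intro h
  have h1 := normSq_denom_sub_normSq_num g z
  rw [h, map_zero] at h1
  have h2 := mem_ball_iff_normSq.mp hz
  have h3 := Complex.normSq_nonneg (g.1 0 0 * z + g.1 0 1)
  linarith

lemma one_sub_normSq_mobius (g : SU11) {z : ℂ} (hz : z ∈ Metric.ball (0 : ℂ) 1) :
    1 - Complex.normSq (mobius g z)
      = (1 - Complex.normSq z) / Complex.normSq (g.1 1 0 * z + g.1 1 1) := by
  have h0 : Complex.normSq (g.1 1 0 * z + g.1 1 1) ≠ 0 :=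
    (Complex.normSq_pos.mpr (denom_ne_zero_of_mem_ball g hz)).ne'
  rw [mobius, Complex.normSq_div, ← normSq_denom_sub_normSq_num g z, sub_div,
    div_self h0]

lemma mobius_mem_ball (g : SU11) {z : ℂ} (hz : z ∈ Metric.ball (0 : ℂ) 1) :
    mobius g z ∈ Metric.ball (0 : ℂ) 1 := by
  rw [mem_ball_iff_normSq, ← sub_pos, one_sub_normSq_mobius g hz]
  exact div_pos (sub_pos.mpr (mem_ball_iff_normSq.mp hz))
    (Complex.normSq_pos.mpr (denom_ne_zero_of_mem_ball g hz))

lemma mobius_mul (g h : SU11) {z : ℂ} (hz : z ∈ Metric.ball (0 : ℂ) 1) :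
    mobius (g * h) z = mobius g (mobius h z) := by
  have h1 := denom_ne_zero_of_mem_ball h hz
  have h2 := denom_ne_zero_of_mem_ball (g * h) hz
  have h3 := denom_ne_zero_of_mem_ball g (mobius_mem_ball h hz)
  simp only [Subgroup.coe_mul, Matrix.SpecialLinearGroup.coe_mul, Matrix.mul_apply,
    Fin.sum_univ_two, mobius] at h2 h3 ⊢
  rw [div_eq_div_iff h2 h3]
  field_simp
  ring

lemma hasDerivAt_mobius (g : SU11) {z : ℂ} (hz : z ∈ Metric.ball (0 : ℂ) 1) :
    HasDerivAt (mobius g) (((g.1 1 0 * z + g.1 1 1) ^ 2)⁻¹) z := by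
  have h1 := denom_ne_zero_of_mem_ball g hz
  have ha : HasDerivAt (fun w : ℂ => g.1 0 0 * w + g.1 0 1) (g.1 0 0) z := by
    simpa using ((hasDerivAt_id z).const_mul (g.1 0 0)).add_const (g.1 0 1)
  have hb : HasDerivAt (fun w : ℂ => g.1 1 0 * w + g.1 1 1) (g.1 1 0) z := by
    simpa using ((hasDerivAt_id z).const_mul (g.1 1 0)).add_const (g.1 1 1)
  have e : g.1 0 0 * (g.1 1 0 * z + g.1 1 1) - (g.1 0 0 * z + g.1 0 1) * g.1 1 0 = 1 := by
    linear_combination det_eq g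
  have := ha.fun_div hb h1
  rw [e, one_div] at this
  exact this

lemma contDiffOn_mobius (g : SU11) : ContDiffOn ℝ 2 (mobius g) (Metric.ball 0 1) := by
  intro z hz
  have h1 : ContDiffAt ℝ 2 (fun w : ℂ => g.1 0 0 * w + g.1 0 1) z := by fun_prop
  have h2 : ContDiffAt ℝ 2 (fun w : ℂ => g.1 1 0 * w + g.1 1 1) z := by fun_prop
  exact ((h1.mul (h2.inv (denom_ne_zero_of_mem_ball g hz))).congr_of_eventuallyEq
    (Eventually.of_forall fun w => div_eq_mul_inv _ _)).contDiffWithinAt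

lemma fderiv_comp_mobius {f : ℂ → ℂ} (hf : ContDiffOn ℝ 2 f (Metric.ball 0 1)) (g : SU11) {z : ℂ}
    (hz : z ∈ Metric.ball (0 : ℂ) 1) (v : ℂ) :
    fderiv ℝ (fun w => f (mobius g w)) z v
      = fderiv ℝ f (mobius g z) (((g.1 1 0 * z + g.1 1 1) ^ 2)⁻¹ * v) := by
  have h1 : HasFDerivAt f (fderiv ℝ f (mobius g z)) (mobius g z) :=
    ((hf.contDiffAt (Metric.isOpen_ball.mem_nhds (mobius_mem_ball g hz))).differentiableAt
      (by norm_num)).hasFDerivAt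
  have h2 := (hasDerivAt_mobius g hz).hasFDerivAt.restrictScalars ℝ
  have h3 := (h1.comp z h2).fderiv
  have h4 : fderiv ℝ (fun w => f (mobius g w)) z = _ := h3
  rw [h4]
  simp [mul_comm]

lemma contDiffOn_comp_mobius {f : ℂ → ℂ} (hf : ContDiffOn ℝ 2 f (Metric.ball 0 1)) (g : SU11) :
    ContDiffOn ℝ 2 (fun w => f (mobius g w)) (Metric.ball 0 1) :=
  hf.comp (contDiffOn_mobius g) fun _ hz => mobius_mem_ball g hz

/-- Obtained by differentiating `fderiv_comp_mobius` along the line `z + t v`. The last term carries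
the complex second derivative of `g`, so it depends on `v` only through the complex square `v ^ 2`.
-/
lemma fderiv_fderiv_comp_mobius {f : ℂ → ℂ} (hf : ContDiffOn ℝ 2 f (Metric.ball 0 1)) (g : SU11)
    {z : ℂ} (hz : z ∈ Metric.ball (0 : ℂ) 1) (v : ℂ) :
    fderiv ℝ (fderiv ℝ (fun w => f (mobius g w))) z v v
      = fderiv ℝ (fderiv ℝ f) (mobius g z) (((g.1 1 0 * z + g.1 1 1) ^ 2)⁻¹ * v)
          (((g.1 1 0 * z + g.1 1 1) ^ 2)⁻¹ * v)
        + fderiv ℝ f (mobius g z) (-2 * g.1 1 0 * ((g.1 1 0 * z + g.1 1 1) ^ 3)⁻¹ * v ^ 2) := by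
  have hl : HasDerivAt (fun t : ℝ => z + t * v) v 0 := by
    simpa using ((Complex.ofRealCLM.hasDerivAt (x := (0 : ℝ))).mul_const v).const_add z
  have hz0 : z + ((0 : ℝ) : ℂ) * v ∈ Metric.ball (0 : ℂ) 1 := by simpa using hz
  have hL := hasDerivAt_fderiv_comp Metric.isOpen_ball (contDiffOn_comp_mobius hf g) hl
    (hasDerivAt_const (0 : ℝ) v) hz0
  have hm : HasDerivAt (fun t : ℝ => mobius g (z + t * v))
      (((g.1 1 0 * z + g.1 1 1) ^ 2)⁻¹ * v) 0 := by
    have h := (hasDerivAt_mobius g hz0).comp_of_eq (0 : ℝ) hl rfl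
    rw [Complex.ofReal_zero, zero_mul, add_zero] at h
    exact h
  have hd : g.1 1 0 * z + g.1 1 1 ≠ 0 := denom_ne_zero_of_mem_ball g hz
  have hm' : HasDerivAt (fun t : ℝ => ((g.1 1 0 * (z + t * v) + g.1 1 1) ^ 2)⁻¹ * v)
      (-2 * g.1 1 0 * ((g.1 1 0 * z + g.1 1 1) ^ 3)⁻¹ * v ^ 2) 0 := by
    have h := ((((hl.const_mul (g.1 1 0)).add_const (g.1 1 1)).fun_pow 2).fun_inv
      (by simpa using hd)).mul_const v
    refine h.congr_deriv ?_
    simp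
    field_simp
  have hR := hasDerivAt_fderiv_comp Metric.isOpen_ball hf hm hm'
    (mobius_mem_ball g hz0)
  have hev : (fun t : ℝ => fderiv ℝ (fun w => f (mobius g w)) (z + t * v) v) =ᶠ[𝓝 0]
      fun t : ℝ => fderiv ℝ f (mobius g (z + t * v)) (((g.1 1 0 * (z + t * v) + g.1 1 1) ^ 2)⁻¹ * v) := by
    have : ∀ᶠ t : ℝ in 𝓝 0, z + t * v ∈ Metric.ball (0 : ℂ) 1 :=
      hl.continuousAt.eventually_mem (Metric.isOpen_ball.mem_nhds hz0)
    filter_upwards [this] with t ht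
    exact fderiv_comp_mobius hf g ht v
  have := hL.unique (hR.congr_of_eventuallyEq hev)
  simpa using this

/-- Bounded eigenfunctions of the hyperbolic Laplacian with bounded hyperbolic gradient. -/
structure IsBoundedEigenfunction (s : ℂ) (C : ℝ) (f : ℂ → ℂ) : Prop where
  contDiffOn : ContDiffOn ℝ 2 f (Metric.ball 0 1)
  eigen : ∀ z ∈ Metric.ball (0 : ℂ) 1,
    (((1 - ‖z‖ ^ 2) ^ 2 / 4 : ℝ) : ℂ) * Laplacian.laplacian f z = -s * (1 - s) * f z
  norm_le : ∀ z ∈ Metric.ball (0 : ℂ) 1, ‖f z‖ ≤ C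
  grad_le : ∀ z ∈ Metric.ball (0 : ℂ) 1, (1 - ‖z‖ ^ 2) * ‖fderiv ℝ f z‖ ≤ C

/-! ### Invariance of bounded eigenfunctions under isometries -/

lemma one_sub_norm_sq_pos {z : ℂ} (hz : z ∈ Metric.ball (0 : ℂ) 1) : 0 < 1 - ‖z‖ ^ 2 := by
  rw [← Complex.normSq_eq_norm_sq]
  exact sub_pos.mpr (mem_ball_iff_normSq.mp hz)

/-- An isometry satisfies |g'(z)| = (1 - |g z|²) / (1 - |z|²), so the hyperbolic length of the
gradient is preserved. -/
lemma grad_comp_mobius_le {f : ℂ → ℂ} (hf : ContDiffOn ℝ 2 f (Metric.ball 0 1)) (g : SU11) {z : ℂ}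
    (hz : z ∈ Metric.ball (0 : ℂ) 1) :
    (1 - ‖z‖ ^ 2) * ‖fderiv ℝ (fun w => f (mobius g w)) z‖
      ≤ (1 - ‖mobius g z‖ ^ 2) * ‖fderiv ℝ f (mobius g z)‖ := by
  have h1 : ‖fderiv ℝ (fun w => f (mobius g w)) z‖
      ≤ ‖fderiv ℝ f (mobius g z)‖ * (‖g.1 1 0 * z + g.1 1 1‖ ^ 2)⁻¹ := by
    refine ContinuousLinearMap.opNorm_le_bound _ (by positivity) fun v => ?_
    rw [fderiv_comp_mobius hf g hz]
    refine (ContinuousLinearMap.le_opNorm _ _).trans_eq ?_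
    rw [norm_mul, norm_inv, norm_pow, mul_assoc]
  refine (mul_le_mul_of_nonneg_left h1 (one_sub_norm_sq_pos hz).le).trans_eq ?_
  have := one_sub_normSq_mobius g hz
  simp only [Complex.normSq_eq_norm_sq] at this
  rw [this]
  ring

/-- The terms with the second derivative of `g` carry 1² and I² = -1 in the two directions, hence
cancel. -/
lemma laplacian_comp_mobius {f : ℂ → ℂ} (hf : ContDiffOn ℝ 2 f (Metric.ball 0 1)) (g : SU11) {z : ℂ}
    (hz : z ∈ Metric.ball (0 : ℂ) 1) :
    Laplacian.laplacian (fun w => f (mobius g w)) z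
      = (((‖g.1 1 0 * z + g.1 1 1‖ ^ 2)⁻¹ ^ 2 : ℝ) : ℂ) * Laplacian.laplacian f (mobius g z) := by
  rw [laplacian_eq_fderiv_fderiv, fderiv_fderiv_comp_mobius hf g hz,
    fderiv_fderiv_comp_mobius hf g hz, laplacian_eq_fderiv_fderiv]
  have h := bilinear_conformal (fderiv ℝ (fderiv ℝ f) (mobius g z))
    (((g.1 1 0 * z + g.1 1 1) ^ 2)⁻¹)
  rw [norm_inv, norm_pow] at h
  rw [← h, Complex.I_sq, mul_neg_one, map_neg, mul_one, one_pow, mul_one,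
    mul_comm Complex.I]
  ring

lemma IsBoundedEigenfunction.comp_mobius {s : ℂ} {C : ℝ} {f : ℂ → ℂ}
    (hf : IsBoundedEigenfunction s C f) (g : SU11) :
    IsBoundedEigenfunction s C (fun w => f (mobius g w)) where
  contDiffOn := contDiffOn_comp_mobius hf.contDiffOn g
  eigen z hz := by
    rw [laplacian_comp_mobius hf.contDiffOn g hz, ← hf.eigen _ (mobius_mem_ball g hz), ← mul_assoc,
      ← Complex.ofReal_mul]
    congr 2
    have := one_sub_normSq_mobius g hz
    simp only [Complex.normSq_eq_norm_sq] at this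
    rw [this]
    ring
  norm_le z hz := hf.norm_le _ (mobius_mem_ball g hz)
  grad_le z hz := (grad_comp_mobius_le hf.contDiffOn g hz).trans
    (hf.grad_le _ (mobius_mem_ball g hz))

/-- Both |f| and the hyperbolic length of its gradient are `Γ`-invariant and continuous, so their
bounds on the compact set `K` hold on the whole disk. -/
lemma IsAutomorphicEigenfunction.exists_isBoundedEigenfunction {Γ : Subgroup SU11} {s : ℂ}
    {f : ℂ → ℂ} (hΓ : IsCocompactFuchsian Γ) (hf : IsAutomorphicEigenfunction Γ s f) :
    ∃ C, IsBoundedEigenfunction s C f := by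
  obtain ⟨K, hK, hKb, hcov⟩ := hΓ.cocompact
  obtain ⟨C₁, hC₁⟩ := hK.exists_bound_of_continuousOn (hf.contDiffOn.continuousOn.mono hKb)
  have hc : ContinuousOn (fderiv ℝ f) (Metric.ball 0 1) :=
    hf.contDiffOn.continuousOn_fderiv_of_isOpen Metric.isOpen_ball (by norm_num)
  have hc' : ContinuousOn (fun z : ℂ => (1 - ‖z‖ ^ 2) * ‖fderiv ℝ f z‖) K := by
    have : ContinuousOn (fun z : ℂ => (1 - ‖z‖ ^ 2)) K := by fun_prop
    exact this.mul (hc.mono hKb).norm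
  obtain ⟨C₂, hC₂⟩ := hK.exists_bound_of_continuousOn hc'
  refine ⟨max C₁ C₂, hf.contDiffOn, hf.eigen, fun z hz => ?_, fun z hz => ?_⟩
  · obtain ⟨g, hg, hgz⟩ := hcov z hz
    rw [← hf.automorphic g hg z hz]
    exact (hC₁ _ hgz).trans (le_max_left _ _)
  · obtain ⟨g, hg, hgz⟩ := hcov z hz
    have h1 : fderiv ℝ f z = fderiv ℝ (fun w => f (mobius g w)) z := by
      apply Filter.EventuallyEq.fderiv_eq
      filter_upwards [Metric.isOpen_ball.mem_nhds hz] with w hw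
      exact (hf.automorphic g hg w hw).symm
    rw [h1]
    exact (grad_comp_mobius_le hf.contDiffOn g hz).trans
      ((le_abs_self _).trans ((hC₂ _ hgz).trans (le_max_right _ _)))

/-! ### Polar coordinates -/

lemma polar_eq (r θ : ℝ) :
    polar r θ = (Real.sinh (r / 2) / Real.cosh (r / 2) : ℝ) * Complex.exp (θ * Complex.I) := by
  rw [polar, Real.tanh_eq_sinh_div_cosh, Circle.coe_exp]

lemma norm_polar (r θ : ℝ) : ‖polar r θ‖ = |Real.tanh (r / 2)| := by
  rw [polar, norm_mul, Circle.norm_coe, mul_one, Complex.norm_real, Real.norm_eq_abs]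

lemma polar_mem_ball (r θ : ℝ) : polar r θ ∈ Metric.ball (0 : ℂ) 1 := by
  rw [mem_ball_zero_iff, norm_polar]
  exact Real.abs_tanh_lt_one _

lemma contDiff_polar : ContDiff ℝ 2 (fun p : ℝ × ℝ => polar p.1 p.2) := by
  have h : (fun p : ℝ × ℝ => polar p.1 p.2) = fun p : ℝ × ℝ =>
      ((Real.sinh (p.1 / 2) / Real.cosh (p.1 / 2) : ℝ) : ℂ) * Complex.exp (p.2 * Complex.I) := by
    funext p
    exact polar_eq p.1 p.2
  rw [h]
  have h1 : ContDiff ℝ 2 (fun p : ℝ × ℝ => Real.sinh (p.1 / 2) / Real.cosh (p.1 / 2)) := by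
    refine ContDiff.div ?_ ?_ fun p => (Real.cosh_pos _).ne'
    · exact Real.contDiff_sinh.comp (by fun_prop)
    · exact Real.contDiff_cosh.comp (by fun_prop)
  have h2 : ContDiff ℝ 2 (fun p : ℝ × ℝ => Complex.exp (p.2 * Complex.I)) := by
    have : ContDiff ℝ 2 (fun p : ℝ × ℝ => (p.2 : ℂ)) := Complex.ofRealCLM.contDiff.comp contDiff_snd
    exact (this.mul contDiff_const).cexp
  exact (Complex.ofRealCLM.contDiff.comp h1).mul h2

lemma hasDerivAt_polar_radial {r : ℝ} (hr : 0 < r) (θ : ℝ) :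
    HasDerivAt (fun ρ => polar ρ θ) (((Real.sinh r)⁻¹ : ℝ) * polar r θ) r := by
  have hc : Real.cosh (r / 2) ≠ 0 := (Real.cosh_pos _).ne'
  have hs : Real.sinh (r / 2) ≠ 0 := (Real.sinh_pos_iff.mpr (by linarith)).ne'
  have h1 : HasDerivAt (fun ρ : ℝ => Real.sinh (ρ / 2) / Real.cosh (ρ / 2))
      ((Real.sinh r)⁻¹ * (Real.sinh (r / 2) / Real.cosh (r / 2))) r := by
    have h2 : HasDerivAt (fun ρ : ℝ => ρ / 2) (1 / 2) r := (hasDerivAt_id r).div_const 2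
    refine (h2.sinh.fun_div h2.cosh hc).congr_deriv ?_
    have h3 : Real.sinh r = 2 * Real.sinh (r / 2) * Real.cosh (r / 2) := by
      rw [← Real.sinh_two_mul]; ring_nf
    have h4 := Real.cosh_sq (r / 2)
    rw [h3]
    field_simp
    linear_combination h4
  have h5 := (h1.ofReal_comp).mul_const (Complex.exp (θ * Complex.I))
  simp only [polar_eq]
  refine h5.congr_deriv ?_
  push_cast
  ring

lemma hasDerivAt_polar_angular (r θ : ℝ) :
    HasDerivAt (fun φ => polar r φ) (Complex.I * polar r θ) θ := by
  have h1 : HasDerivAt (fun φ : ℝ => Complex.exp (φ * Complex.I))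
      (Complex.exp (θ * Complex.I) * (1 * Complex.I)) θ :=
    ((Complex.ofRealCLM.hasDerivAt (x := θ)).mul_const Complex.I).cexp
  simp only [polar_eq]
  refine (h1.const_mul _).congr_deriv ?_
  ring

lemma hasDerivAt_inv_sinh {r : ℝ} (hr : 0 < r) :
    HasDerivAt (fun ρ => (Real.sinh ρ)⁻¹) (-Real.cosh r / Real.sinh r ^ 2) r :=
  (Real.hasDerivAt_sinh r).fun_inv (Real.sinh_pos_iff.mpr hr).ne'

/-- For `r ≥ 0` the right side is twice the modulus of `polar r θ`. This is how a bound on the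
hyperbolic gradient becomes a bound on derivatives in polar coordinates. -/
lemma sinh_mul_one_sub_norm_polar_sq (r θ : ℝ) :
    Real.sinh r * (1 - ‖polar r θ‖ ^ 2) = 2 * Real.tanh (r / 2) := by
  have hc : Real.cosh (r / 2) ≠ 0 := (Real.cosh_pos _).ne'
  have h3 : Real.sinh r = 2 * Real.sinh (r / 2) * Real.cosh (r / 2) := by
    rw [← Real.sinh_two_mul]; ring_nf
  have h4 := Real.cosh_sq (r / 2)
  rw [norm_polar, sq_abs, Real.tanh_eq_sinh_div_cosh, h3]
  field_simp
  linear_combination (Real.sinh (r/2)) * h4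

/-- The hyperbolic translation along the real axis by the distance `τ`. -/
def translation (τ : ℝ) : SU11 :=
  ⟨⟨!![(Real.cosh (τ / 2) : ℂ), (Real.sinh (τ / 2) : ℂ);
      (Real.sinh (τ / 2) : ℂ), (Real.cosh (τ / 2) : ℂ)], by
      rw [Matrix.det_fin_two_of]
      have := Real.cosh_sq (τ / 2)
      norm_cast
      linear_combination this⟩, by
    change _ ∧ _
    simp [-Complex.ofReal_cosh, -Complex.ofReal_sinh]⟩

lemma mobius_translation (τ : ℝ) (z : ℂ) :
    mobius (translation τ) z = ((Real.cosh (τ / 2) : ℝ) * z + (Real.sinh (τ / 2) : ℝ))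
      / ((Real.sinh (τ / 2) : ℝ) * z + (Real.cosh (τ / 2) : ℝ)) := rfl

lemma translation_denom_ne_zero (τ : ℝ) {z : ℂ} (hz : z ∈ Metric.ball (0 : ℂ) 1) :
    ((Real.sinh (τ / 2) : ℝ) * z + (Real.cosh (τ / 2) : ℝ) : ℂ) ≠ 0 :=
  denom_ne_zero_of_mem_ball (translation τ) hz

/-- The translations form a one-parameter group, so the velocity at time `τ` is the complex
derivative of the translation times the Killing field (1 - z²) / 2 at the starting point. -/
lemma hasDerivAt_mobius_translation (τ : ℝ) {z : ℂ} (hz : z ∈ Metric.ball (0 : ℂ) 1) :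
    HasDerivAt (fun σ : ℝ => mobius (translation σ) z)
      ((((Real.sinh (τ / 2) : ℝ) * z + (Real.cosh (τ / 2) : ℝ) : ℂ) ^ 2)⁻¹ * ((1 - z ^ 2) / 2)) τ := by
  have h2 : HasDerivAt (fun ρ : ℝ => ρ / 2) (1 / 2) τ := (hasDerivAt_id τ).div_const 2
  have hs := h2.sinh.ofReal_comp
  have hc := h2.cosh.ofReal_comp
  have hd := translation_denom_ne_zero τ hz
  have h := ((hc.mul_const z).add hs).fun_div ((hs.mul_const z).add hc) hd
  simp only [mobius_translation]
  refine h.congr_deriv ?_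
  have h4 := Real.cosh_sq (τ / 2)
  have h5 : ((Real.cosh (τ / 2) : ℝ) : ℂ) ^ 2 = ((Real.sinh (τ / 2) : ℝ) : ℂ) ^ 2 + 1 := by
    exact_mod_cast h4
  simp only [Pi.add_apply]
  rw [div_eq_inv_mul]
  congr 1
  push_cast at h5 ⊢
  linear_combination (1 / 2 - z ^ 2 / 2) * h5

/-- The function `f` in the polar coordinates `(r, θ)` about the origin, moved by the translation of
length `τ`. -/
def translatedPolar (f : ℂ → ℂ) (p : ℝ × ℝ × ℝ) : ℂ :=
  f (mobius (translation p.1) (polar p.2.1 p.2.2))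

lemma contDiff_translatedPolar {f : ℂ → ℂ} (hf : ContDiffOn ℝ 2 f (Metric.ball 0 1)) :
    ContDiff ℝ 2 (translatedPolar f) := by
  have hs : ContDiff ℝ 2 (fun p : ℝ × ℝ × ℝ => ((Real.sinh (p.1 / 2) : ℝ) : ℂ)) :=
    Complex.ofRealCLM.contDiff.comp (Real.contDiff_sinh.comp (by fun_prop))
  have hc : ContDiff ℝ 2 (fun p : ℝ × ℝ × ℝ => ((Real.cosh (p.1 / 2) : ℝ) : ℂ)) :=
    Complex.ofRealCLM.contDiff.comp (Real.contDiff_cosh.comp (by fun_prop))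
  have hz : ContDiff ℝ 2 (fun p : ℝ × ℝ × ℝ => polar p.2.1 p.2.2) := contDiff_polar.comp contDiff_snd
  have h : ContDiff ℝ 2 (fun p : ℝ × ℝ × ℝ => mobius (translation p.1) (polar p.2.1 p.2.2)) := by
    simp only [mobius_translation, div_eq_mul_inv]
    exact ((hc.mul hz).add hs).mul (((hs.mul hz).add hc).inv fun p =>
      translation_denom_ne_zero p.1 (polar_mem_ball _ _))
  exact hf.comp_contDiff h fun p => mobius_mem_ball _ (polar_mem_ball _ _)

lemma hasDerivAt_slice₁ {E : Type*} [NormedAddCommGroup E] [NormedSpace ℝ E]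
    {Φ : ℝ × ℝ × ℝ → E} (hΦ : Differentiable ℝ Φ) (τ r θ : ℝ) :
    HasDerivAt (fun x => Φ (x, r, θ)) (fderiv ℝ Φ (τ, r, θ) (1, 0, 0)) τ :=
  (hΦ (τ, r, θ)).hasFDerivAt.comp_hasDerivAt τ
    ((hasDerivAt_id τ).prodMk ((hasDerivAt_const τ r).prodMk (hasDerivAt_const τ θ)))

lemma hasDerivAt_slice₂ {E : Type*} [NormedAddCommGroup E] [NormedSpace ℝ E]
    {Φ : ℝ × ℝ × ℝ → E} (hΦ : Differentiable ℝ Φ) (τ r θ : ℝ) :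
    HasDerivAt (fun x => Φ (τ, x, θ)) (fderiv ℝ Φ (τ, r, θ) (0, 1, 0)) r :=
  (hΦ (τ, r, θ)).hasFDerivAt.comp_hasDerivAt r
    ((hasDerivAt_const r τ).prodMk ((hasDerivAt_id r).prodMk (hasDerivAt_const r θ)))

lemma hasDerivAt_slice₃ {E : Type*} [NormedAddCommGroup E] [NormedSpace ℝ E]
    {Φ : ℝ × ℝ × ℝ → E} (hΦ : Differentiable ℝ Φ) (τ r θ : ℝ) :
    HasDerivAt (fun x => Φ (τ, r, x)) (fderiv ℝ Φ (τ, r, θ) (0, 0, 1)) θ :=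
  (hΦ (τ, r, θ)).hasFDerivAt.comp_hasDerivAt θ
    ((hasDerivAt_const θ τ).prodMk ((hasDerivAt_const θ r).prodMk (hasDerivAt_id θ)))

lemma differentiable_translatedPolar {f : ℂ → ℂ} (hf : ContDiffOn ℝ 2 f (Metric.ball 0 1)) :
    Differentiable ℝ (translatedPolar f) :=
  (contDiff_translatedPolar hf).differentiable (by norm_num)

lemma differentiable_fderiv_translatedPolar {f : ℂ → ℂ} (hf : ContDiffOn ℝ 2 f (Metric.ball 0 1)) :
    Differentiable ℝ (fderiv ℝ (translatedPolar f)) :=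
  ((contDiff_translatedPolar hf).fderiv_right (m := 1) (by norm_num)).differentiable (by norm_num)

/-- The first derivatives of `f` in polar coordinates. -/
lemma fderiv_translatedPolar_radial {f : ℂ → ℂ} (hf : ContDiffOn ℝ 2 f (Metric.ball 0 1))
    (τ : ℝ) {r : ℝ} (hr : 0 < r) (θ : ℝ) :
    fderiv ℝ (translatedPolar f) (τ, r, θ) (0, 1, 0)
      = fderiv ℝ (fun z => f (mobius (translation τ) z)) (polar r θ)
          (((Real.sinh r)⁻¹ : ℝ) * polar r θ) :=
  (hasDerivAt_slice₂ (differentiable_translatedPolar hf) τ r θ).unique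
    (hasDerivAt_comp_of_contDiffOn Metric.isOpen_ball (contDiffOn_comp_mobius hf (translation τ))
      (hasDerivAt_polar_radial hr θ) (polar_mem_ball r θ))

lemma fderiv_translatedPolar_angular {f : ℂ → ℂ} (hf : ContDiffOn ℝ 2 f (Metric.ball 0 1))
    (τ r θ : ℝ) :
    fderiv ℝ (translatedPolar f) (τ, r, θ) (0, 0, 1)
      = fderiv ℝ (fun z => f (mobius (translation τ) z)) (polar r θ) (Complex.I * polar r θ) :=
  (hasDerivAt_slice₃ (differentiable_translatedPolar hf) τ r θ).unique
    (hasDerivAt_comp_of_contDiffOn Metric.isOpen_ball (contDiffOn_comp_mobius hf (translation τ))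
      (hasDerivAt_polar_angular r θ) (polar_mem_ball r θ))

/-- The Killing field of the translations in polar coordinates. -/
lemma killing_polar {r : ℝ} (hr : 0 < r) (θ : ℝ) :
    (1 - polar r θ ^ 2) / 2 = (Real.cos θ : ℝ) * (((Real.sinh r)⁻¹ : ℝ) * polar r θ)
      - ((Real.cosh r / Real.sinh r * Real.sin θ : ℝ) : ℂ) * (Complex.I * polar r θ) := by
  have hc : ((Real.cosh (r / 2) : ℝ) : ℂ) ≠ 0 := by exact_mod_cast (Real.cosh_pos _).ne'
  have hs : ((Real.sinh (r / 2) : ℝ) : ℂ) ≠ 0 := by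
    exact_mod_cast (Real.sinh_pos_iff.mpr (by linarith)).ne'
  have h3 : Real.sinh r = 2 * Real.sinh (r / 2) * Real.cosh (r / 2) := by
    rw [← Real.sinh_two_mul]; ring_nf
  have h3' : Real.cosh r = Real.cosh (r / 2) ^ 2 + Real.sinh (r / 2) ^ 2 := by
    rw [← Real.cosh_two_mul]; ring_nf
  have h4 : ((Real.cosh (r / 2) : ℝ) : ℂ) ^ 2 = ((Real.sinh (r / 2) : ℝ) : ℂ) ^ 2 + 1 := by
    exact_mod_cast Real.cosh_sq (r / 2)
  have he : Complex.exp (θ * Complex.I) = (Real.cos θ : ℝ) + (Real.sin θ : ℝ) * Complex.I := by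
    rw [Complex.exp_mul_I]; push_cast; rfl
  have hcs : ((Real.cos θ : ℝ) : ℂ) ^ 2 + ((Real.sin θ : ℝ) : ℂ) ^ 2 = 1 := by
    exact_mod_cast Real.cos_sq_add_sin_sq θ
  rw [polar_eq, he, h3, h3']
  generalize Real.cosh (r / 2) = c at *
  generalize Real.sinh (r / 2) = x at *
  generalize Real.cos θ = u at *
  generalize Real.sin θ = v at *
  push_cast
  field_simp
  have hI := Complex.I_sq
  linear_combination (1 + Complex.I * v * (u + v * Complex.I)) * h4 - (1 + (x : ℂ) ^ 2) * hcs
    + (1 + (x : ℂ) ^ 2) * v ^ 2 * hI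

lemma fderiv_translatedPolar_translation {f : ℂ → ℂ} (hf : ContDiffOn ℝ 2 f (Metric.ball 0 1))
    (τ : ℝ) {r : ℝ} (hr : 0 < r) (θ : ℝ) :
    fderiv ℝ (translatedPolar f) (τ, r, θ) (1, 0, 0)
      = (Real.cos θ : ℝ) * fderiv ℝ (translatedPolar f) (τ, r, θ) (0, 1, 0)
        - ((Real.cosh r / Real.sinh r * Real.sin θ : ℝ) : ℂ)
          * fderiv ℝ (translatedPolar f) (τ, r, θ) (0, 0, 1) := by
  have hz := polar_mem_ball r θ
  have h := (hasDerivAt_slice₁ (differentiable_translatedPolar hf) τ r θ).unique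
    (hasDerivAt_comp_of_contDiffOn Metric.isOpen_ball hf (hasDerivAt_mobius_translation τ hz)
      (mobius_mem_ball _ hz))
  rw [h, fderiv_translatedPolar_radial hf τ hr, fderiv_translatedPolar_angular hf τ, killing_polar hr,
    mul_sub, map_sub, fderiv_comp_mobius hf _ hz, fderiv_comp_mobius hf _ hz, mul_left_comm,
    mul_left_comm _ ((Real.cosh r / Real.sinh r * Real.sin θ : ℝ) : ℂ)]
  simp only [← Complex.real_smul, map_smul]
  rfl

/-- Every `τ` is allowed because the translated function is again an eigenfunction. -/
lemma polar_laplace {s : ℂ} {C : ℝ} {f : ℂ → ℂ} (hf : IsBoundedEigenfunction s C f)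
    (τ : ℝ) {r : ℝ} (hr : 0 < r) (θ : ℝ) :
    fderiv ℝ (fderiv ℝ (translatedPolar f)) (τ, r, θ) (0, 1, 0) (0, 1, 0)
      + ((Real.cosh r / Real.sinh r : ℝ) : ℂ) * fderiv ℝ (translatedPolar f) (τ, r, θ) (0, 1, 0)
      + (((Real.sinh r ^ 2)⁻¹ : ℝ) : ℂ)
        * fderiv ℝ (fderiv ℝ (translatedPolar f)) (τ, r, θ) (0, 0, 1) (0, 0, 1)
      = -s * (1 - s) * translatedPolar f (τ, r, θ) := by
  have hsr : Real.sinh r ≠ 0 := (Real.sinh_pos_iff.mpr hr).ne'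
  have hg := hf.comp_mobius (translation τ)
  have hΦ := differentiable_fderiv_translatedPolar hf.contDiffOn
  have hz := polar_mem_ball r θ
  have hrr := ((hasDerivAt_slice₂ hΦ τ r θ).clm_apply (hasDerivAt_const r (0, 1, 0))).unique
    ((hasDerivAt_fderiv_comp (c₁ := fun ρ => ((Real.sinh ρ)⁻¹ : ℝ) * polar ρ θ)
      Metric.isOpen_ball hg.contDiffOn (hasDerivAt_polar_radial hr θ)
      (((hasDerivAt_inv_sinh hr).ofReal_comp).mul (hasDerivAt_polar_radial hr θ))
      hz).congr_of_eventuallyEq (by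
        filter_upwards [lt_mem_nhds hr] with ρ hρ
        exact fderiv_translatedPolar_radial hf.contDiffOn τ hρ θ))
  have hθθ := ((hasDerivAt_slice₃ hΦ τ r θ).clm_apply (hasDerivAt_const θ (0, 0, 1))).unique
    ((hasDerivAt_fderiv_comp (c₁ := fun φ => Complex.I * polar r φ)
      Metric.isOpen_ball hg.contDiffOn (hasDerivAt_polar_angular r θ)
      ((hasDerivAt_polar_angular r θ).const_mul Complex.I) hz).congr_of_eventuallyEq
        (Eventually.of_forall fun φ => fderiv_translatedPolar_angular hf.contDiffOn τ r φ))
  rw [map_zero, add_zero] at hrr hθθ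
  have hB := bilinear_conformal
    (fderiv ℝ (fderiv ℝ (fun z => f (mobius (translation τ) z))) (polar r θ)) (polar r θ)
  rw [← laplacian_eq_fderiv_fderiv] at hB
  have he := hg.eigen _ hz
  -- This turns the trace of the second derivative along `polar r θ` and its rotation into sinh² r
  -- times the hyperbolic Laplacian.
  have hn : ‖polar r θ‖ ^ 2 = Real.sinh r ^ 2 * ((1 - ‖polar r θ‖ ^ 2) ^ 2 / 4) := by
    have := sinh_mul_one_sub_norm_polar_sq r θ
    have h2 : ‖polar r θ‖ ^ 2 = Real.tanh (r / 2) ^ 2 := by rw [norm_polar, sq_abs]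
    calc _ = (2 * Real.tanh (r / 2)) ^ 2 / 4 := by rw [h2]; ring
      _ = _ := by rw [← this]; ring
  rw [hn, Complex.ofReal_mul, mul_assoc, he] at hB
  rw [hrr, hθθ, fderiv_translatedPolar_radial hf.contDiffOn τ hr]
  -- The accelerations of the radial and the angular curve are real multiples of `polar r θ`; their
  -- contributions cancel against the coth term, leaving only second derivatives of the function.
  have e1 : ((-Real.cosh r / Real.sinh r ^ 2 : ℝ) : ℂ) * polar r θ
        + ((Real.sinh r)⁻¹ : ℝ) * (((Real.sinh r)⁻¹ : ℝ) * polar r θ)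
      = (-Real.cosh r / Real.sinh r ^ 2 + (Real.sinh r)⁻¹ ^ 2 : ℝ) • polar r θ := by
    rw [Complex.real_smul]; push_cast; ring
  have e2 : Complex.I * (Complex.I * polar r θ) = (-1 : ℝ) • polar r θ := by
    rw [← mul_assoc, Complex.I_mul_I, Complex.real_smul]; simp
  rw [e1, e2]
  simp only [← Complex.real_smul, map_smul, _root_.smul_apply]
  simp only [Complex.real_smul]
  have hsr' : ((Real.sinh r : ℝ) : ℂ) ≠ 0 := by exact_mod_cast hsr
  change _ = -s * (1 - s) * f (mobius (translation τ) (polar r θ))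
  push_cast at hB hsr' ⊢
  field_simp
  linear_combination hB

lemma norm_translatedPolar_le {s : ℂ} {C : ℝ} {f : ℂ → ℂ} (hf : IsBoundedEigenfunction s C f)
    (p : ℝ × ℝ × ℝ) : ‖translatedPolar f p‖ ≤ C :=
  hf.norm_le _ (mobius_mem_ball _ (polar_mem_ball _ _))

lemma norm_polar_mul_norm_fderiv_le {s : ℂ} {C : ℝ} {f : ℂ → ℂ}
    (hf : IsBoundedEigenfunction s C f) {r : ℝ} (hr : 0 < r) (θ : ℝ) :
    ‖fderiv ℝ f (polar r θ)‖ * ‖polar r θ‖ ≤ C * Real.sinh r := by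
  have hsr := Real.sinh_pos_iff.mpr hr
  have hT : 0 ≤ Real.tanh (r / 2) := by
    rw [Real.tanh_eq_sinh_div_cosh]
    exact div_nonneg (Real.sinh_nonneg_iff.mpr (by linarith)) (Real.cosh_pos _).le
  have h2 := sinh_mul_one_sub_norm_polar_sq r θ
  have h3 := mul_le_mul_of_nonneg_right (hf.grad_le _ (polar_mem_ball r θ)) hsr.le
  have h4 : (1 - ‖polar r θ‖ ^ 2) * ‖fderiv ℝ f (polar r θ)‖ * Real.sinh r
      = 2 * (‖fderiv ℝ f (polar r θ)‖ * Real.tanh (r / 2)) := by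
    linear_combination ‖fderiv ℝ f (polar r θ)‖ * h2
  have h5 : 0 ≤ ‖fderiv ℝ f (polar r θ)‖ * Real.tanh (r / 2) := mul_nonneg (norm_nonneg _) hT
  rw [norm_polar, abs_of_nonneg hT]
  linarith

lemma norm_fderiv_translatedPolar_angular_le {s : ℂ} {C : ℝ} {f : ℂ → ℂ}
    (hf : IsBoundedEigenfunction s C f) (τ : ℝ) {r : ℝ} (hr : 0 < r) (θ : ℝ) :
    ‖fderiv ℝ (translatedPolar f) (τ, r, θ) (0, 0, 1)‖ ≤ C * Real.sinh r := by
  rw [fderiv_translatedPolar_angular hf.contDiffOn]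
  refine (ContinuousLinearMap.le_opNorm _ _).trans ?_
  rw [norm_mul, Complex.norm_I, one_mul]
  exact norm_polar_mul_norm_fderiv_le (hf.comp_mobius (translation τ)) hr θ

lemma norm_fderiv_translatedPolar_radial_le {s : ℂ} {C : ℝ} {f : ℂ → ℂ}
    (hf : IsBoundedEigenfunction s C f) (τ : ℝ) {r : ℝ} (hr : 0 < r) (θ : ℝ) :
    ‖fderiv ℝ (translatedPolar f) (τ, r, θ) (0, 1, 0)‖ ≤ C := by
  have hsr := Real.sinh_pos_iff.mpr hr
  rw [fderiv_translatedPolar_radial hf.contDiffOn τ hr]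
  refine (ContinuousLinearMap.le_opNorm _ _).trans ?_
  rw [norm_mul, Complex.norm_real, Real.norm_of_nonneg (inv_nonneg.mpr hsr.le), mul_left_comm,
    inv_mul_le_iff₀ hsr, mul_comm (Real.sinh r)]
  exact norm_polar_mul_norm_fderiv_le (hf.comp_mobius (translation τ)) hr θ

/-! ### Oscillatory estimates -/

lemma hasDerivAt_intervalIntegral_of_continuous {G g : ℝ → ℝ → ℂ} {a b : ℝ}
    (hG : ∀ x η, HasDerivAt (fun y => G y η) (g x η) x) (hGc : ∀ x, Continuous (G x))
    (hg : Continuous fun p : ℝ × ℝ => g p.1 p.2) (x : ℝ) :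
    HasDerivAt (fun y => ∫ η in a..b, G y η) (∫ η in a..b, g x η) x := by
  obtain ⟨K, hK⟩ := ((isCompact_Icc (a := x - 1) (b := x + 1)).prod
    (isCompact_uIcc (a := a) (b := b))).exists_bound_of_continuousOn hg.continuousOn
  have hgx : Continuous (g x) := hg.comp (by fun_prop : Continuous fun η => (x, η))
  refine (intervalIntegral.hasDerivAt_integral_of_dominated_loc_of_deriv_le (F := G) (F' := g)
    (bound := fun _ => K) (Icc_mem_nhds (a := x - 1) (b := x + 1) (by linarith) (by linarith))
    (Eventually.of_forall fun y => (hGc y).aestronglyMeasurable) ((hGc x).intervalIntegrable a b)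
    hgx.aestronglyMeasurable ?_ intervalIntegrable_const ?_).2
  · exact Eventually.of_forall fun η hη y hy => hK (y, η) ⟨hy, uIoc_subset_uIcc hη⟩
  · exact Eventually.of_forall fun η _ y _ => hG y η

/-- Integration by parts: two boundary terms and one integral of length `b - a`. Only the supremum
of `Q` enters, so no bound on the second derivatives of `f` is ever needed. -/
lemma norm_integral_mul_deriv_le {w w' Q Q' : ℝ → ℂ} {a b W q : ℝ} (hab : a ≤ b)
    (hw : ∀ x, HasDerivAt w (w' x) x) (hQ : ∀ x, HasDerivAt Q (Q' x) x) (hw' : Continuous w')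
    (hQ' : Continuous Q') (hW : ∀ x ∈ Icc a b, ‖w x‖ ≤ W) (hW' : ∀ x ∈ Icc a b, ‖w' x‖ ≤ W)
    (hq : ∀ x ∈ Icc a b, ‖Q x‖ ≤ q) :
    ‖∫ x in a..b, w x * Q' x‖ ≤ (2 + (b - a)) * W * q := by
  have ha : a ∈ Icc a b := left_mem_Icc.mpr hab
  have hb : b ∈ Icc a b := right_mem_Icc.mpr hab
  have hW0 : 0 ≤ W := (norm_nonneg _).trans (hW a ha)
  have key : ∀ x ∈ Icc a b, ∀ u : ℂ, ‖u‖ ≤ W → ‖u * Q x‖ ≤ W * q := fun x hx u hu => by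
    rw [norm_mul]; exact mul_le_mul hu (hq x hx) (norm_nonneg _) hW0
  rw [intervalIntegral.integral_mul_deriv_eq_deriv_mul (fun x _ => hw x) (fun x _ => hQ x)
    (hw'.intervalIntegrable a b) (hQ'.intervalIntegrable a b)]
  have h1 : ‖∫ x in a..b, w' x * Q x‖ ≤ W * q * |b - a| := by
    refine intervalIntegral.norm_integral_le_of_norm_le_const fun x hx => ?_
    have hx' : x ∈ Icc a b := by
      rw [uIoc_of_le hab] at hx; exact Ioc_subset_Icc_self hx
    exact key x hx' _ (hW' x hx')
  rw [abs_of_nonneg (by linarith)] at h1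
  refine (norm_sub_le _ _).trans ((add_le_add (norm_sub_le _ _) h1).trans ?_)
  have := key b hb _ (hW b hb)
  have := key a ha _ (hW a ha)
  nlinarith

/-- The function `∂f/∂r + s f` in polar coordinates. -/
def radialPart (s : ℂ) (f : ℂ → ℂ) (p : ℝ × ℝ × ℝ) : ℂ :=
  fderiv ℝ (translatedPolar f) p (0, 1, 0) + s * translatedPolar f p

lemma hasFDerivAt_radialPart {s : ℂ} {f : ℂ → ℂ} (hf : ContDiffOn ℝ 2 f (Metric.ball 0 1))
    (p : ℝ × ℝ × ℝ) :
    HasFDerivAt (radialPart s f) ((fderiv ℝ (fderiv ℝ (translatedPolar f)) p).flip (0, 1, 0)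
      + s • fderiv ℝ (translatedPolar f) p) p := by
  have h1 := (differentiable_fderiv_translatedPolar hf p).hasFDerivAt.clm_apply
    (hasFDerivAt_const ((0 : ℝ), (1 : ℝ), (0 : ℝ)) p)
  have h2 := (differentiable_translatedPolar hf p).hasFDerivAt.const_mul s
  refine (h1.add h2).congr_fderiv ?_
  ext <;> simp

lemma differentiable_radialPart {s : ℂ} {f : ℂ → ℂ} (hf : ContDiffOn ℝ 2 f (Metric.ball 0 1)) :
    Differentiable ℝ (radialPart s f) := fun p => (hasFDerivAt_radialPart hf p).differentiableAt

lemma continuous_fderiv_translatedPolar {f : ℂ → ℂ} (hf : ContDiffOn ℝ 2 f (Metric.ball 0 1)) :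
    Continuous (fderiv ℝ (translatedPolar f)) :=
  (differentiable_fderiv_translatedPolar hf).continuous

lemma continuous_fderiv_fderiv_translatedPolar {f : ℂ → ℂ}
    (hf : ContDiffOn ℝ 2 f (Metric.ball 0 1)) :
    Continuous (fderiv ℝ (fderiv ℝ (translatedPolar f))) :=
  ((contDiff_translatedPolar hf).fderiv_right (m := 1) (by norm_num)).continuous_fderiv (by norm_num)

lemma fderiv_radialPart_apply {s : ℂ} {f : ℂ → ℂ} (hf : ContDiffOn ℝ 2 f (Metric.ball 0 1))
    (p v : ℝ × ℝ × ℝ) : fderiv ℝ (radialPart s f) p v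
      = fderiv ℝ (fderiv ℝ (translatedPolar f)) p v (0, 1, 0)
        + s * fderiv ℝ (translatedPolar f) p v := by
  rw [(hasFDerivAt_radialPart hf p).fderiv]
  simp

lemma continuous_fderiv_radialPart {s : ℂ} {f : ℂ → ℂ} (hf : ContDiffOn ℝ 2 f (Metric.ball 0 1)) :
    Continuous (fderiv ℝ (radialPart s f)) := by
  have h : fderiv ℝ (radialPart s f) = fun p => (fderiv ℝ (fderiv ℝ (translatedPolar f)) p).flip
      (0, 1, 0) + s • fderiv ℝ (translatedPolar f) p :=
    funext fun p => (hasFDerivAt_radialPart hf p).fderiv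
  rw [h]
  have h1 := continuous_fderiv_fderiv_translatedPolar hf
  have h2 : Continuous fun p => (fderiv ℝ (fderiv ℝ (translatedPolar f)) p).flip :=
    (ContinuousLinearMap.flipₗᵢ ℝ (ℝ × ℝ × ℝ) (ℝ × ℝ × ℝ) ℂ).continuous.comp h1
  exact (h2.clm_apply continuous_const).add ((continuous_fderiv_translatedPolar hf).const_smul s)

lemma norm_radialPart_le {s : ℂ} {C : ℝ} {f : ℂ → ℂ} (hf : IsBoundedEigenfunction s C f) (τ : ℝ)
    {r : ℝ} (hr : 0 < r) (θ : ℝ) : ‖radialPart s f (τ, r, θ)‖ ≤ (1 + ‖s‖) * C := by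
  refine (norm_add_le _ _).trans ?_
  rw [norm_mul, add_mul, one_mul]
  exact add_le_add (norm_fderiv_translatedPolar_radial_le hf τ hr θ)
    (mul_le_mul_of_nonneg_left (norm_translatedPolar_le hf _) (norm_nonneg _))

lemma norm_cexp_neg_mul {s : ℂ} (hs : s.re = 1 / 2) (r : ℝ) :
    ‖Complex.exp (-s * r)‖ = Real.exp (-(1 / 2) * r) := by
  rw [Complex.norm_exp]
  simp [hs]

/-- The integrals over arcs of large hyperbolic circles which define the Helgason distribution
converge. -/
lemma exists_tendsto_integral_radialPart {s : ℂ} (hs : s.re = 1 / 2) {C : ℝ} {f : ℂ → ℂ}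
    (hf : IsBoundedEigenfunction s C f) {v : ℝ → ℂ} (hv : ContDiff ℝ 1 v) {a b : ℝ} (hab : a ≤ b) :
    ∃ L : ℂ, Tendsto (fun r : ℝ => ∫ θ in a..b, v θ *
      (Complex.exp (-s * r) * radialPart s f (0, r, θ) * (Real.sinh r : ℝ))) atTop (𝓝 L) := by
  have hf₂ := hf.contDiffOn
  have hΦc := (differentiable_translatedPolar hf₂).continuous
  have hDc := continuous_fderiv_translatedPolar hf₂
  have hDDc := continuous_fderiv_fderiv_translatedPolar hf₂
  have hRc := (differentiable_radialPart (s := s) hf₂).continuous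
  have hDRc := continuous_fderiv_radialPart (s := s) hf₂
  have hC : 0 ≤ C := (norm_nonneg _).trans (norm_translatedPolar_le hf (0, 0, 0))
  have hvd : ∀ x, HasDerivAt v (deriv v x) x := fun x =>
    (hv.differentiable (by norm_num) x).hasDerivAt
  have hvc : Continuous v := hv.continuous
  have hv'c : Continuous (deriv v) := hv.continuous_deriv (by norm_num)
  obtain ⟨V₁, hV₁⟩ := (isCompact_Icc (a := a) (b := b)).exists_bound_of_continuousOn hvc.continuousOn
  obtain ⟨V₂, hV₂⟩ := (isCompact_Icc (a := a) (b := b)).exists_bound_of_continuousOn hv'c.continuousOn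
  set V := max V₁ V₂
  have hVv : ∀ x ∈ Icc a b, ‖v x‖ ≤ V := fun x hx => (hV₁ x hx).trans (le_max_left _ _)
  have hVv' : ∀ x ∈ Icc a b, ‖deriv v x‖ ≤ V := fun x hx => (hV₂ x hx).trans (le_max_right _ _)
  have hV : 0 ≤ V := (norm_nonneg _).trans (hVv a (left_mem_Icc.mpr hab))
  let g : ℝ → ℝ → ℂ := fun r θ => v θ * ((-s * Complex.exp (-s * r) * radialPart s f (0, r, θ)
    + Complex.exp (-s * r) * fderiv ℝ (radialPart s f) (0, r, θ) (0, 1, 0)) * (Real.sinh r : ℝ)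
    + Complex.exp (-s * r) * radialPart s f (0, r, θ) * (Real.cosh r : ℝ))
  have hder : ∀ r, HasDerivAt (fun r : ℝ => ∫ θ in a..b, v θ *
      (Complex.exp (-s * r) * radialPart s f (0, r, θ) * (Real.sinh r : ℝ)))
      (∫ θ in a..b, g r θ) r := by
    refine hasDerivAt_intervalIntegral_of_continuous (fun r θ => ?_) (fun r => ?_) ?_
    · refine HasDerivAt.const_mul _ ?_
      have h1 : HasDerivAt (fun r : ℝ => Complex.exp (-s * r)) (-s * Complex.exp (-s * r)) r := by
        refine (((Complex.ofRealCLM.hasDerivAt (x := r)).const_mul (-s)).cexp).congr_deriv ?_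
        simp [mul_comm]
      exact (h1.mul (hasDerivAt_slice₂ (differentiable_radialPart hf₂) 0 r θ)).mul
        (Real.hasDerivAt_sinh r).ofReal_comp
    · fun_prop
    · have := Real.continuous_sinh
      have := Real.continuous_cosh
      fun_prop
  have hbound : ∀ r : ℝ, 0 < r → ‖∫ θ in a..b, g r θ‖
      ≤ (‖s‖ * (V * C * (b - a)) + (2 + (b - a)) * V * C) * Real.exp (-(1 / 2) * r) := by
    intro r hr
    have hsr := Real.sinh_pos_iff.mpr hr
    have hsr' : ((Real.sinh r : ℝ) : ℂ) ≠ 0 := by exact_mod_cast hsr.ne'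
    -- The eigenvalue equation removes the second radial derivative, and cosh r - sinh r leaves the
    -- small factor e^{-r} in front of `f`.
    have hge : ∀ θ, g r θ = Complex.exp (-s * r) * ((s * (Real.exp (-r) : ℝ))
        * (v θ * translatedPolar f (0, r, θ))
        - ((Real.sinh r)⁻¹ : ℝ) * (v θ * fderiv ℝ (fderiv ℝ (translatedPolar f)) (0, r, θ)
          (0, 0, 1) (0, 0, 1))) := by
      intro θ
      have h := polar_laplace hf 0 hr θ
      simp only [g, fderiv_radialPart_apply hf₂, radialPart]
      rw [← Real.cosh_sub_sinh]
      push_cast at h hsr' ⊢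
      field_simp at h ⊢
      linear_combination (v θ) * h
    have hi1 : IntervalIntegrable (fun θ => v θ * translatedPolar f (0, r, θ))
        MeasureTheory.volume a b := Continuous.intervalIntegrable (by fun_prop) a b
    have hi2 : IntervalIntegrable (fun θ => v θ * fderiv ℝ (fderiv ℝ (translatedPolar f)) (0, r, θ)
          (0, 0, 1) (0, 0, 1)) MeasureTheory.volume a b :=
      Continuous.intervalIntegrable (by fun_prop) a b
    simp_rw [hge]
    rw [intervalIntegral.integral_const_mul, intervalIntegral.integral_sub (hi1.const_mul _)
      (hi2.const_mul _), intervalIntegral.integral_const_mul, intervalIntegral.integral_const_mul,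
      norm_mul, norm_cexp_neg_mul hs, mul_comm]
    refine mul_le_mul_of_nonneg_right ((norm_sub_le _ _).trans (add_le_add ?_ ?_)) (Real.exp_nonneg _)
    · have h1 : ‖∫ θ in a..b, v θ * translatedPolar f (0, r, θ)‖ ≤ V * C * |b - a| := by
        refine intervalIntegral.norm_integral_le_of_norm_le_const fun x hx => ?_
        rw [uIoc_of_le hab] at hx
        rw [norm_mul]
        exact mul_le_mul (hVv x (Ioc_subset_Icc_self hx)) (norm_translatedPolar_le hf _)
          (norm_nonneg _) hV
      rw [abs_of_nonneg (by linarith)] at h1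
      rw [norm_mul, norm_mul, Complex.norm_real, Real.norm_of_nonneg (Real.exp_nonneg _), mul_assoc]
      refine mul_le_mul_of_nonneg_left ?_ (norm_nonneg _)
      have h2 : Real.exp (-r) ≤ 1 := Real.exp_le_one_iff.mpr (by linarith)
      calc _ ≤ 1 * (V * C * (b - a)) := mul_le_mul h2 h1 (norm_nonneg _) zero_le_one
        _ = _ := one_mul _
    -- The angular derivative is O(sinh r), which the prefactor 1 / sinh r exactly compensates.
    · have hQ : ∀ θ, HasDerivAt (fun θ => fderiv ℝ (translatedPolar f) (0, r, θ) (0, 0, 1))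
          (fderiv ℝ (fderiv ℝ (translatedPolar f)) (0, r, θ) (0, 0, 1) (0, 0, 1)) θ := fun θ => by
        have := (hasDerivAt_slice₃ (differentiable_fderiv_translatedPolar hf₂) 0 r θ).clm_apply
          (hasDerivAt_const θ ((0 : ℝ), (0 : ℝ), (1 : ℝ)))
        simpa using this
      have h1 := norm_integral_mul_deriv_le hab hvd hQ hv'c (by fun_prop) hVv hVv'
        (fun θ _ => norm_fderiv_translatedPolar_angular_le hf 0 hr θ)
      rw [norm_mul, Complex.norm_real, Real.norm_of_nonneg (inv_nonneg.mpr hsr.le),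
        inv_mul_le_iff₀ hsr]
      exact h1.trans_eq (by ring)
  have hgc : Continuous fun r => ∫ θ in a..b, g r θ := by
    refine intervalIntegral.continuous_parametric_intervalIntegral_of_continuous' ?_ a b
    have := Real.continuous_sinh
    have := Real.continuous_cosh
    fun_prop
  have hint : MeasureTheory.IntegrableOn (fun r => ∫ θ in a..b, g r θ) (Ioi 0) := by
    refine MeasureTheory.Integrable.mono' ((integrableOn_exp_mul_Ioi (a := -(1 / 2)) (by norm_num)
      0).const_mul (‖s‖ * (V * C * (b - a)) + (2 + (b - a)) * V * C)) hgc.aestronglyMeasurable ?_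
    exact MeasureTheory.ae_restrict_of_forall_mem measurableSet_Ioi fun r hr => hbound r hr
  exact ⟨_, MeasureTheory.tendsto_limUnder_of_hasDerivAt_of_integrableOn_Ioi (fun r _ => hder r) hint⟩

/-! ### The flow of the translations on the circle at infinity -/

/-- `|a_τ'|⁻¹` at the boundary point of angle `η`, for the translation `a_τ` of length `-τ`. -/
def flowDenom (τ η : ℝ) : ℝ := Real.cosh τ - Real.sinh τ * Real.cos η

/-- The action on angles of the translation of length `-τ`. -/
def flowAngle (τ η : ℝ) : ℝ :=
  η + 2 * Real.arctan (Real.sinh (τ / 2) * Real.sin η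
    / (Real.cosh (τ / 2) - Real.sinh (τ / 2) * Real.cos η))

lemma cosh_sub_sinh_mul_cos_pos (x η : ℝ) : 0 < Real.cosh x - Real.sinh x * Real.cos η := by
  have h1 : |Real.sinh x| < Real.cosh x := by
    rw [abs_lt]
    have h2 := Real.cosh_sub_sinh x
    have h3 := Real.cosh_add_sinh x
    constructor <;> nlinarith [Real.exp_pos x, Real.exp_pos (-x)]
  have h2 : |Real.sinh x * Real.cos η| ≤ |Real.sinh x| := by
    rw [abs_mul]
    exact mul_le_of_le_one_right (abs_nonneg _) (Real.abs_cos_le_one η)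
  linarith [le_abs_self (Real.sinh x * Real.cos η)]

lemma flowDenom_pos (τ η : ℝ) : 0 < flowDenom τ η := cosh_sub_sinh_mul_cos_pos τ η

lemma cosh_eq_half (τ : ℝ) : Real.cosh τ = Real.cosh (τ / 2) ^ 2 + Real.sinh (τ / 2) ^ 2 := by
  rw [← Real.cosh_two_mul]; ring_nf

lemma sinh_eq_half (τ : ℝ) : Real.sinh τ = 2 * Real.sinh (τ / 2) * Real.cosh (τ / 2) := by
  rw [← Real.sinh_two_mul]; ring_nf

/-- The right side is |c z + d|² for the matrix of the inverse translation at the boundary point of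
angle `η`. -/
lemma flowDenom_eq (τ η : ℝ) : flowDenom τ η
    = (Real.cosh (τ / 2) - Real.sinh (τ / 2) * Real.cos η) ^ 2
      + (Real.sinh (τ / 2) * Real.sin η) ^ 2 := by
  rw [flowDenom, cosh_eq_half τ, sinh_eq_half τ]
  linear_combination -(Real.sinh (τ / 2)) ^ 2 * Real.cos_sq_add_sin_sq η

lemma contDiff_flowDenom : ContDiff ℝ 1 (fun p : ℝ × ℝ => flowDenom p.1 p.2) := by
  unfold flowDenom
  exact (Real.contDiff_cosh.comp contDiff_fst).sub
    ((Real.contDiff_sinh.comp contDiff_fst).mul (Real.contDiff_cos.comp contDiff_snd))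

lemma contDiff_flowAngle : ContDiff ℝ 1 (fun p : ℝ × ℝ => flowAngle p.1 p.2) := by
  unfold flowAngle
  have hc : ContDiff ℝ 1 fun p : ℝ × ℝ => Real.cosh (p.1 / 2) :=
    Real.contDiff_cosh.comp (by fun_prop)
  have hs : ContDiff ℝ 1 fun p : ℝ × ℝ => Real.sinh (p.1 / 2) :=
    Real.contDiff_sinh.comp (by fun_prop)
  have hcos : ContDiff ℝ 1 fun p : ℝ × ℝ => Real.cos p.2 := Real.contDiff_cos.comp contDiff_snd
  have hsin : ContDiff ℝ 1 fun p : ℝ × ℝ => Real.sin p.2 := Real.contDiff_sin.comp contDiff_snd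
  exact contDiff_snd.add (contDiff_const.mul (((hs.mul hsin).div (hc.sub (hs.mul hcos))
    fun p => (cosh_sub_sinh_mul_cos_pos _ _).ne').arctan))

lemma hasDerivAt_flowDenom (τ η : ℝ) :
    HasDerivAt (fun σ => flowDenom σ η) (Real.sinh τ - Real.cosh τ * Real.cos η) τ :=
  (Real.hasDerivAt_cosh τ).sub ((Real.hasDerivAt_sinh τ).mul_const _)

/-- By `sin_flowAngle` the velocity is the sine of the current angle: the flow integrates the field
sin θ ∂_θ. -/
lemma hasDerivAt_flowAngle_time (τ η : ℝ) :
    HasDerivAt (fun σ => flowAngle σ η) (Real.sin η / flowDenom τ η) τ := by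
  have h2 : HasDerivAt (fun ρ : ℝ => ρ / 2) (1 / 2) τ := (hasDerivAt_id τ).div_const 2
  have hd := (cosh_sub_sinh_mul_cos_pos (τ / 2) η).ne'
  have h := (((h2.sinh.mul_const (Real.sin η)).fun_div
    (h2.cosh.sub (h2.sinh.mul_const (Real.cos η))) hd).arctan.const_mul 2).const_add η
  refine h.congr_deriv ?_
  have hN := flowDenom_pos τ η
  rw [flowDenom_eq] at hN ⊢
  have h4 := Real.cosh_sq (τ / 2)
  simp only [Pi.sub_apply]
  have hq : (1 + (Real.sinh (τ / 2) * Real.sin η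
      / (Real.cosh (τ / 2) - Real.sinh (τ / 2) * Real.cos η)) ^ 2) ≠ 0 := by positivity
  field_simp
  linear_combination (Real.sin η) * h4

lemma hasDerivAt_flowAngle (τ η : ℝ) :
    HasDerivAt (fun x => flowAngle τ x) (flowDenom τ η)⁻¹ η := by
  have hd := (cosh_sub_sinh_mul_cos_pos (τ / 2) η).ne'
  have h := (hasDerivAt_id η).add (((((Real.hasDerivAt_sin η).const_mul (Real.sinh (τ / 2))).fun_div
    (((Real.hasDerivAt_cos η).const_mul (Real.sinh (τ / 2))).const_sub (Real.cosh (τ / 2)))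
      hd)).arctan.const_mul 2)
  refine h.congr_deriv ?_
  have hN := flowDenom_pos τ η
  rw [flowDenom_eq] at hN ⊢
  have h4 := Real.cosh_sq (τ / 2)
  have hq : (1 + (Real.sinh (τ / 2) * Real.sin η
      / (Real.cosh (τ / 2) - Real.sinh (τ / 2) * Real.cos η)) ^ 2) ≠ 0 := by positivity
  have hcs := Real.cos_sq_add_sin_sq η
  field_simp
  linear_combination h4 - (Real.sinh (τ / 2)) ^ 2 * hcs

lemma cos_two_mul_arctan_div (x : ℝ) {d : ℝ} (hd : d ≠ 0) :
    Real.cos (2 * Real.arctan (x / d)) = (d ^ 2 - x ^ 2) / (d ^ 2 + x ^ 2) := by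
  have h : d ^ 2 + x ^ 2 ≠ 0 := by positivity
  have h' : 1 + (x / d) ^ 2 ≠ 0 := by positivity
  rw [Real.cos_two_mul, Real.cos_sq_arctan]
  field_simp
  ring

lemma sin_two_mul_arctan_div (x : ℝ) {d : ℝ} (hd : d ≠ 0) :
    Real.sin (2 * Real.arctan (x / d)) = 2 * d * x / (d ^ 2 + x ^ 2) := by
  have h : d ^ 2 + x ^ 2 ≠ 0 := by positivity
  have h' : 1 + (x / d) ^ 2 ≠ 0 := by positivity
  have h1 : Real.sin (Real.arctan (x / d)) = x / d * Real.cos (Real.arctan (x / d)) := by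
    rw [Real.sin_arctan, Real.cos_arctan]; ring
  have h2 : 2 * (x / d * Real.cos (Real.arctan (x / d))) * Real.cos (Real.arctan (x / d))
      = 2 * (x / d) * Real.cos (Real.arctan (x / d)) ^ 2 := by ring
  rw [Real.sin_two_mul, h1, h2, Real.cos_sq_arctan]
  field_simp

lemma cos_flowAngle (τ η : ℝ) : Real.cos (flowAngle τ η)
    = (Real.cosh τ * Real.cos η - Real.sinh τ) / flowDenom τ η := by
  have hd := (cosh_sub_sinh_mul_cos_pos (τ / 2) η).ne'
  rw [flowAngle, Real.cos_add, cos_two_mul_arctan_div _ hd, sin_two_mul_arctan_div _ hd,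
    ← flowDenom_eq, mul_div_assoc', mul_div_assoc', ← sub_div, cosh_eq_half τ, sinh_eq_half τ]
  congr 1
  linear_combination (-2 * Real.cosh (τ / 2) * Real.sinh (τ / 2)
    + Real.sinh (τ / 2) ^ 2 * Real.cos η) * Real.cos_sq_add_sin_sq η

lemma sin_flowAngle (τ η : ℝ) : Real.sin (flowAngle τ η) = Real.sin η / flowDenom τ η := by
  have hd := (cosh_sub_sinh_mul_cos_pos (τ / 2) η).ne'
  rw [flowAngle, Real.sin_add, cos_two_mul_arctan_div _ hd, sin_two_mul_arctan_div _ hd,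
    ← flowDenom_eq, mul_div_assoc', mul_div_assoc', ← add_div]
  congr 1
  linear_combination Real.sin η * Real.cosh_sq (τ / 2)
    - Real.sin η * Real.sinh (τ / 2) ^ 2 * Real.cos_sq_add_sin_sq η

lemma flowDenom_zero (η : ℝ) : flowDenom 0 η = 1 := by simp [flowDenom]

lemma flowAngle_zero (η : ℝ) : flowAngle 0 η = η := by simp [flowAngle]

lemma flowAngle_apply_zero (τ : ℝ) : flowAngle τ 0 = 0 := by simp [flowAngle]

lemma flowAngle_add_two_pi (τ η : ℝ) :
    flowAngle τ (η + 2 * Real.pi) = flowAngle τ η + 2 * Real.pi := by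
  simp only [flowAngle, Real.sin_add_two_pi, Real.cos_add_two_pi]
  ring

lemma flowDenom_add_two_pi (τ η : ℝ) : flowDenom τ (η + 2 * Real.pi) = flowDenom τ η := by
  simp only [flowDenom, Real.cos_add_two_pi]

/-- The factor `|a_τ'|^(1 - s)` which the flow contributes to arc integrals. -/
def flowFactor (s : ℂ) (τ η : ℝ) : ℂ := Complex.exp (-(1 - s) * (Real.log (flowDenom τ η) : ℝ))

lemma flowFactor_zero (s : ℂ) (η : ℝ) : flowFactor s 0 η = 1 := by
  simp [flowFactor, flowDenom_zero]

lemma contDiff_flowFactor (s : ℂ) : ContDiff ℝ 1 (fun p : ℝ × ℝ => flowFactor s p.1 p.2) := by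
  unfold flowFactor
  exact (contDiff_const.mul (Complex.ofRealCLM.contDiff.comp
    (contDiff_flowDenom.log fun p => (flowDenom_pos _ _).ne'))).cexp

lemma hasDerivAt_flowFactor (s : ℂ) (τ η : ℝ) :
    HasDerivAt (fun σ => flowFactor s σ η)
      ((1 - s) * (Real.cos (flowAngle τ η) : ℝ) * flowFactor s τ η) τ := by
  have h := (((hasDerivAt_flowDenom τ η).log (flowDenom_pos τ η).ne').ofReal_comp.const_mul
    (-(1 - s))).cexp
  refine h.congr_deriv ?_
  rw [cos_flowAngle, flowFactor]
  push_cast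
  ring

/-- The infinitesimal equivariance of `e^{-s r} (∂f/∂r + s f)` under translations. -/
lemma radialPart_flow {s : ℂ} {C : ℝ} {f : ℂ → ℂ} (hf : IsBoundedEigenfunction s C f)
    (τ : ℝ) {r : ℝ} (hr : 0 < r) (θ : ℝ) :
    (1 - s) * (Real.cos θ : ℝ) * radialPart s f (τ, r, θ)
      + fderiv ℝ (radialPart s f) (τ, r, θ) (1, 0, Real.sin θ)
    = -((Real.exp (-r) / Real.sinh r : ℝ) : ℂ)
        * ((Real.cos θ : ℝ) * fderiv ℝ (translatedPolar f) (τ, r, θ) (0, 1, 0)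
          + (Real.sin θ : ℝ) * fderiv ℝ (radialPart s f) (τ, r, θ) (0, 0, 1))
      + (((Real.sinh r ^ 2)⁻¹ : ℝ) : ℂ)
        * ((Real.sin θ : ℝ) * fderiv ℝ (translatedPolar f) (τ, r, θ) (0, 0, 1)
          - (Real.cos θ : ℝ) * fderiv ℝ (fderiv ℝ (translatedPolar f)) (τ, r, θ)
            (0, 0, 1) (0, 0, 1)) := by
  have hf₂ := hf.contDiffOn
  have hΦ := differentiable_fderiv_translatedPolar hf₂
  have hsr : Real.sinh r ≠ 0 := (Real.sinh_pos_iff.mpr hr).ne'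
  have hsymm : IsSymmSndFDerivAt ℝ (translatedPolar f) (τ, r, θ) :=
    (contDiff_translatedPolar hf₂).contDiffAt.isSymmSndFDerivAt (by simp)
  have hD : ∀ v : ℝ × ℝ × ℝ, HasDerivAt (fun ρ => fderiv ℝ (translatedPolar f) (τ, ρ, θ) v)
      (fderiv ℝ (fderiv ℝ (translatedPolar f)) (τ, r, θ) (0, 1, 0) v) r := fun v => by
    simpa using (hasDerivAt_slice₂ hΦ τ r θ).clm_apply (hasDerivAt_const r v)
  have hcoth : HasDerivAt (fun ρ => Real.cosh ρ / Real.sinh ρ * Real.sin θ)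
      (-(Real.sinh r ^ 2)⁻¹ * Real.sin θ) r := by
    refine (((Real.hasDerivAt_cosh r).fun_div (Real.hasDerivAt_sinh r) hsr).mul_const _).congr_deriv ?_
    have := Real.cosh_sq r
    field_simp
    linear_combination (-Real.sin θ) * this
  -- The Killing formula is differentiated in `r`; the derivative of coth is the source of the term
  -- sin θ ∂_θ f / sinh² r. Symmetry of second derivatives then turns the left side into the
  -- `τ`-derivative of ∂f/∂r.
  have h1 := (hD (1, 0, 0)).unique ((((hD (0, 1, 0)).const_mul ((Real.cos θ : ℝ) : ℂ)).sub
    (hcoth.ofReal_comp.mul (hD (0, 0, 1)))).congr_of_eventuallyEq (by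
      filter_upwards [lt_mem_nhds hr] with ρ hρ
      exact fderiv_translatedPolar_translation hf₂ τ hρ θ))
  rw [hsymm (0, 1, 0) (1, 0, 0), hsymm (0, 1, 0) (0, 0, 1)] at h1
  have h2 := fderiv_translatedPolar_translation hf₂ τ hr θ
  have h3 := polar_laplace hf τ hr θ
  have hv : ((1 : ℝ), (0 : ℝ), Real.sin θ) = (1, 0, 0) + Real.sin θ • ((0 : ℝ), (0 : ℝ), (1 : ℝ)) := by
    simp
  -- The factor e^{-r} / sinh r is coth r - 1, the defect between the angular part of the Killing
  -- field and its limit at infinity.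
  rw [hv, map_add, map_smul, Complex.real_smul, fderiv_radialPart_apply hf₂,
    fderiv_radialPart_apply hf₂, h1, h2, radialPart, ← Real.cosh_sub_sinh]
  have hsr' : ((Real.sinh r : ℝ) : ℂ) ≠ 0 := by exact_mod_cast hsr
  push_cast at h3 hsr' ⊢
  generalize Complex.sinh r = S at *
  generalize Complex.cosh r = K at *
  field_simp at h3 ⊢
  linear_combination (Complex.cos θ) * h3

/-! ### Transport of arc integrals along the translation flow -/

lemma exists_bound_slice {W : ℝ × ℝ → ℂ} (hW : ContDiff ℝ 1 W) (t a b : ℝ) :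
    ∃ K, ∀ τ ∈ Icc 0 t, ∀ η ∈ Icc a b, ‖W (τ, η)‖ ≤ K ∧ ‖fderiv ℝ W (τ, η) (0, 1)‖ ≤ K := by
  have hc := (isCompact_Icc (a := (0 : ℝ)) (b := t)).prod (isCompact_Icc (a := a) (b := b))
  obtain ⟨K₁, h₁⟩ := hc.exists_bound_of_continuousOn hW.continuous.continuousOn
  obtain ⟨K₂, h₂⟩ := hc.exists_bound_of_continuousOn
    ((hW.continuous_fderiv (by norm_num)).clm_apply
      (continuous_const (y := ((0 : ℝ), (1 : ℝ))))).continuousOn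
  exact ⟨max K₁ K₂, fun τ hτ η hη => ⟨(h₁ _ ⟨hτ, hη⟩).trans (le_max_left _ _),
    (h₂ _ ⟨hτ, hη⟩).trans (le_max_right _ _)⟩⟩

lemma continuous_slice {E : Type*} [TopologicalSpace E] {F : ℝ → ℝ → E}
    (hF : Continuous fun p : ℝ × ℝ => F p.1 p.2) (τ : ℝ) : Continuous (F τ) :=
  hF.comp (Continuous.prodMk_right τ)

lemma hasDerivAt_slice {W : ℝ × ℝ → ℂ} (hW : ContDiff ℝ 1 W) (τ η : ℝ) :
    HasDerivAt (fun x => W (τ, x)) (fderiv ℝ W (τ, η) (0, 1)) η :=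
  ((hW.differentiable (by norm_num)) (τ, η)).hasFDerivAt.comp_hasDerivAt η
    ((hasDerivAt_const η τ).prodMk (hasDerivAt_id η))

lemma intervalIntegral_linear_combination {F₁ F₂ F₃ F₄ : ℝ → ℂ} (h₁ : Continuous F₁)
    (h₂ : Continuous F₂) (h₃ : Continuous F₃) (h₄ : Continuous F₄) (a b : ℝ) (c d : ℂ) :
    ∫ x in a..b, (c * (F₁ x + F₂ x) + d * (F₃ x - F₄ x))
      = c * ((∫ x in a..b, F₁ x) + ∫ x in a..b, F₂ x)
        + d * ((∫ x in a..b, F₃ x) - ∫ x in a..b, F₄ x) := by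
  have hi : ∀ {F : ℝ → ℂ}, Continuous F → IntervalIntegrable F MeasureTheory.volume a b :=
    fun h => h.intervalIntegrable a b
  rw [intervalIntegral.integral_add (hi (by fun_prop)) (hi (by fun_prop)),
    intervalIntegral.integral_const_mul, intervalIntegral.integral_const_mul,
    intervalIntegral.integral_add (hi h₁) (hi h₂), intervalIntegral.integral_sub (hi h₃) (hi h₄)]

/-- The `τ`-derivative of the integrand of a transported arc integral. -/
def flowIntegrandDeriv (s : ℂ) (f : ℂ → ℂ) (v : ℝ → ℂ) (r τ η : ℝ) : ℂ :=
  v η * (flowFactor s τ η * (Complex.exp (-s * r)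
    * ((1 - s) * (Real.cos (flowAngle τ η) : ℝ) * radialPart s f (τ, r, flowAngle τ η)
      + fderiv ℝ (radialPart s f) (τ, r, flowAngle τ η) (1, 0, Real.sin (flowAngle τ η)))
    * (Real.sinh r : ℝ)))

lemma hasDerivAt_comp_path {Φ : ℝ × ℝ × ℝ → ℂ} (hΦ : Differentiable ℝ Φ) (r : ℝ) {φ : ℝ → ℝ}
    {φ' τ : ℝ} (hφ : HasDerivAt φ φ' τ) :
    HasDerivAt (fun σ => Φ (σ, r, φ σ)) (fderiv ℝ Φ (τ, r, φ τ) (1, 0, φ')) τ :=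
  (hΦ (τ, r, φ τ)).hasFDerivAt.comp_hasDerivAt τ
    ((hasDerivAt_id τ).prodMk ((hasDerivAt_const τ r).prodMk hφ))

lemma hasDerivAt_integral_flow {s : ℂ} {f : ℂ → ℂ} (hf₂ : ContDiffOn ℝ 2 f (Metric.ball 0 1))
    {v : ℝ → ℂ} (hvc : Continuous v) (a b r τ : ℝ) :
    HasDerivAt (fun τ : ℝ => ∫ η in a..b, v η * (flowFactor s τ η *
      (Complex.exp (-s * r) * radialPart s f (τ, r, flowAngle τ η) * (Real.sinh r : ℝ))))
      (∫ η in a..b, flowIntegrandDeriv s f v r τ η) τ := by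
  have hRc := (differentiable_radialPart (s := s) hf₂).continuous
  have hDRc := continuous_fderiv_radialPart (s := s) hf₂
  have hA := contDiff_flowAngle
  have hAc : Continuous fun p : ℝ × ℝ => flowAngle p.1 p.2 := hA.continuous
  have hAc' : ∀ τ, Continuous (flowAngle τ) := continuous_slice hAc
  have hEc : Continuous fun p : ℝ × ℝ => flowFactor s p.1 p.2 := (contDiff_flowFactor s).continuous
  have hEc' : ∀ τ, Continuous (flowFactor s τ) := continuous_slice hEc
  refine hasDerivAt_intervalIntegral_of_continuous (G := fun τ η => v η * (flowFactor s τ η *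
      (Complex.exp (-s * r) * radialPart s f (τ, r, flowAngle τ η) * (Real.sinh r : ℝ))))
    (g := flowIntegrandDeriv s f v r) (fun τ η => ?_) (fun τ => ?_) ?_ τ
  · unfold flowIntegrandDeriv
    refine HasDerivAt.const_mul _ ?_
    have h1 : HasDerivAt (fun τ => radialPart s f (τ, r, flowAngle τ η))
        (fderiv ℝ (radialPart s f) (τ, r, flowAngle τ η) (1, 0, Real.sin (flowAngle τ η))) τ := by
      rw [sin_flowAngle]
      exact hasDerivAt_comp_path (differentiable_radialPart hf₂) r (hasDerivAt_flowAngle_time τ η)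
    refine ((hasDerivAt_flowFactor s τ η).mul ((h1.const_mul _).mul_const _)).congr_deriv ?_
    ring
  · fun_prop
  · unfold flowIntegrandDeriv
    have h1 : Continuous fun p : ℝ × ℝ => ((Real.cos (flowAngle p.1 p.2) : ℝ) : ℂ) :=
      Complex.continuous_ofReal.comp hA.cos.continuous
    have h2 : Continuous fun p : ℝ × ℝ => Real.sin (flowAngle p.1 p.2) := hA.sin.continuous
    fun_prop

/-- In `radialPart_flow`, the terms bounded by first derivatives are estimated directly, while those
with second derivatives of `f` are integrated by parts in `η`. The bound is uniform in `τ` because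
the weights are C¹ on a compact rectangle. -/
lemma exists_norm_integral_flowIntegrandDeriv_le {s : ℂ} (hs : s.re = 1 / 2) {C : ℝ} {f : ℂ → ℂ}
    (hf : IsBoundedEigenfunction s C f) {v : ℝ → ℂ} (hv : ContDiff ℝ 1 v) {a b : ℝ} (hab : a ≤ b)
    {t : ℝ} (ht : 0 ≤ t) :
    ∃ M : ℝ, ∀ r : ℝ, 0 < r → ∀ τ ∈ Icc 0 t,
      ‖∫ η in a..b, flowIntegrandDeriv s f v r τ η‖ ≤ M * Real.exp (-(1 / 2) * r) := by
  have hf₂ := hf.contDiffOn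
  have hDc := continuous_fderiv_translatedPolar hf₂
  have hDDc := continuous_fderiv_fderiv_translatedPolar hf₂
  have hDRc := continuous_fderiv_radialPart (s := s) hf₂
  have hA := contDiff_flowAngle
  have hAc : Continuous fun p : ℝ × ℝ => flowAngle p.1 p.2 := hA.continuous
  have hAc' : ∀ τ, Continuous (flowAngle τ) := continuous_slice hAc
  have hE := contDiff_flowFactor s
  have hN := contDiff_flowDenom
  have hNc : Continuous fun p : ℝ × ℝ => flowDenom p.1 p.2 := hN.continuous
  have hNc' : ∀ τ, Continuous (flowDenom τ) := continuous_slice hNc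
  have hv2 : ContDiff ℝ 1 fun p : ℝ × ℝ => v p.2 := hv.comp contDiff_snd
  have hcos : ContDiff ℝ 1 fun p : ℝ × ℝ => ((Real.cos (flowAngle p.1 p.2) : ℝ) : ℂ) :=
    Complex.ofRealCLM.contDiff.comp hA.cos
  have hsin : ContDiff ℝ 1 fun p : ℝ × ℝ => ((Real.sin (flowAngle p.1 p.2) : ℝ) : ℂ) :=
    Complex.ofRealCLM.contDiff.comp hA.sin
  have hden : ContDiff ℝ 1 fun p : ℝ × ℝ => ((flowDenom p.1 p.2 : ℝ) : ℂ) :=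
    Complex.ofRealCLM.contDiff.comp hN
  let U₁ : ℝ × ℝ → ℂ := fun p => v p.2 * flowFactor s p.1 p.2 * (Real.cos (flowAngle p.1 p.2) : ℝ)
  let U₂ : ℝ × ℝ → ℂ := fun p => v p.2 * flowFactor s p.1 p.2 * (Real.sin (flowAngle p.1 p.2) : ℝ)
  -- The chain rule along `flowAngle τ` brings a factor `(flowDenom τ η)⁻¹` into `Q₁'` and `Q₂'`;
  -- the weights `W₁`, `W₂` compensate for it.
  let W₁ : ℝ × ℝ → ℂ := fun p => U₁ p * (flowDenom p.1 p.2 : ℝ)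
  let W₂ : ℝ × ℝ → ℂ := fun p => U₂ p * (flowDenom p.1 p.2 : ℝ)
  have hU₁ : ContDiff ℝ 1 U₁ := (hv2.mul hE).mul hcos
  have hU₂ : ContDiff ℝ 1 U₂ := (hv2.mul hE).mul hsin
  have hW₁ : ContDiff ℝ 1 W₁ := hU₁.mul hden
  have hW₂ : ContDiff ℝ 1 W₂ := hU₂.mul hden
  obtain ⟨K₁, hK₁⟩ := exists_bound_slice hU₁ t a b
  obtain ⟨K₂, hK₂⟩ := exists_bound_slice hU₂ t a b
  obtain ⟨K₃, hK₃⟩ := exists_bound_slice hW₁ t a b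
  obtain ⟨K₄, hK₄⟩ := exists_bound_slice hW₂ t a b
  have hnn : ∀ {K : ℝ} {W : ℝ × ℝ → ℂ}, (∀ τ ∈ Icc 0 t, ∀ η ∈ Icc a b, ‖W (τ, η)‖ ≤ K ∧
      ‖fderiv ℝ W (τ, η) (0, 1)‖ ≤ K) → 0 ≤ K := fun h =>
    (norm_nonneg _).trans (h 0 (left_mem_Icc.mpr ht) a (left_mem_Icc.mpr hab)).1
  have hK₁0 := hnn hK₁
  have hK₂0 := hnn hK₂
  refine ⟨K₁ * C * (b - a) + (2 + (b - a)) * K₄ * ((1 + ‖s‖) * C)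
    + (K₂ * C * (b - a) + (2 + (b - a)) * K₃ * C), ?_⟩
  intro r hr τ hτ
  have hsr := Real.sinh_pos_iff.mpr hr
  let Q₁ : ℝ → ℂ := fun η => radialPart s f (τ, r, flowAngle τ η)
  let Q₁' : ℝ → ℂ := fun η => ((flowDenom τ η)⁻¹ : ℝ)
    * fderiv ℝ (radialPart s f) (τ, r, flowAngle τ η) (0, 0, 1)
  let Q₂ : ℝ → ℂ := fun η => fderiv ℝ (translatedPolar f) (τ, r, flowAngle τ η) (0, 0, 1)
  let Q₂' : ℝ → ℂ := fun η => ((flowDenom τ η)⁻¹ : ℝ)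
    * fderiv ℝ (fderiv ℝ (translatedPolar f)) (τ, r, flowAngle τ η) (0, 0, 1) (0, 0, 1)
  have hQ₁ : ∀ η, HasDerivAt Q₁ (Q₁' η) η := fun η =>
    (hasDerivAt_slice₃ (differentiable_radialPart hf₂) τ r (flowAngle τ η)).scomp η
      (hasDerivAt_flowAngle τ η)
  have hQ₂ : ∀ η, HasDerivAt Q₂ (Q₂' η) η := fun η => by
    have h := (hasDerivAt_slice₃ (differentiable_fderiv_translatedPolar hf₂) τ r
      (flowAngle τ η)).clm_apply (hasDerivAt_const (flowAngle τ η) ((0 : ℝ), (0 : ℝ), (1 : ℝ)))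
    rw [map_zero, add_zero] at h
    exact h.scomp η (hasDerivAt_flowAngle τ η)
  have hinv : Continuous fun η => (((flowDenom τ η)⁻¹ : ℝ) : ℂ) :=
    Complex.continuous_ofReal.comp ((hNc' τ).inv₀ fun η => (flowDenom_pos τ η).ne')
  have hA' := hAc' τ
  have hQ₁'c : Continuous Q₁' := hinv.mul (by fun_prop)
  have hQ₂'c : Continuous Q₂' := hinv.mul (by fun_prop)
  have hQ₂c : Continuous Q₂ := by fun_prop
  let R : ℝ → ℂ := fun η => fderiv ℝ (translatedPolar f) (τ, r, flowAngle τ η) (0, 1, 0)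
  have hRc' : Continuous R := by fun_prop
  have hslice : ∀ {W : ℝ × ℝ → ℂ}, ContDiff ℝ 1 W → Continuous fun η => W (τ, η) := fun h =>
    h.continuous.comp (Continuous.prodMk_right τ)
  have hslice' : ∀ {W : ℝ × ℝ → ℂ}, ContDiff ℝ 1 W →
      Continuous fun η => fderiv ℝ W (τ, η) (0, 1) := fun h =>
    ((h.continuous_fderiv (by norm_num)).comp (Continuous.prodMk_right τ)).clm_apply
      continuous_const
  have hge : ∀ η, flowIntegrandDeriv s f v r τ η = Complex.exp (-s * r) * (Real.sinh r : ℝ)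
      * (-((Real.exp (-r) / Real.sinh r : ℝ) : ℂ) * (U₁ (τ, η) * R η + W₂ (τ, η) * Q₁' η)
        + (((Real.sinh r ^ 2)⁻¹ : ℝ) : ℂ) * (U₂ (τ, η) * Q₂ η - W₁ (τ, η) * Q₂' η)) := by
    intro η
    have h := radialPart_flow hf τ hr (flowAngle τ η)
    have hn : ((flowDenom τ η : ℝ) : ℂ) ≠ 0 := by exact_mod_cast (flowDenom_pos τ η).ne'
    simp only [flowIntegrandDeriv, h, U₁, U₂, W₁, W₂, Q₁', Q₂', Q₂, R, Complex.ofReal_inv (flowDenom τ η)]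
    rw [mul_assoc _ ((flowDenom τ η : ℝ) : ℂ), mul_inv_cancel_left₀ hn,
      mul_assoc _ ((flowDenom τ η : ℝ) : ℂ), mul_inv_cancel_left₀ hn]
    ring
  have i1 : Continuous fun η => U₁ (τ, η) * R η := (hslice hU₁).mul hRc'
  have i2 : Continuous fun η => W₂ (τ, η) * Q₁' η := (hslice hW₂).mul hQ₁'c
  have i3 : Continuous fun η => U₂ (τ, η) * Q₂ η := (hslice hU₂).mul hQ₂c
  have i4 : Continuous fun η => W₁ (τ, η) * Q₂' η := (hslice hW₁).mul hQ₂'c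
  simp_rw [hge]
  rw [intervalIntegral.integral_const_mul, intervalIntegral_linear_combination i1 i2 i3 i4]
  have hle : ∀ {K q : ℝ} {F G : ℝ → ℂ}, 0 ≤ K → (∀ η ∈ Icc a b, ‖F η‖ ≤ K) →
      (∀ η, ‖G η‖ ≤ q) → ‖∫ η in a..b, F η * G η‖ ≤ K * q * (b - a) := by
    intro K q F G hK hF hG
    have h1 : ‖∫ η in a..b, F η * G η‖ ≤ K * q * |b - a| := by
      refine intervalIntegral.norm_integral_le_of_norm_le_const fun x hx => ?_
      rw [uIoc_of_le hab] at hx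
      rw [norm_mul]
      exact mul_le_mul (hF x (Ioc_subset_Icc_self hx)) (hG x) (norm_nonneg _) hK
    rwa [abs_of_nonneg (by linarith)] at h1
  have n1 := hle (G := R) hK₁0 (fun η hη => (hK₁ τ hτ η hη).1)
    (fun η => norm_fderiv_translatedPolar_radial_le hf τ hr _)
  have n3 := hle (G := Q₂) hK₂0 (fun η hη => (hK₂ τ hτ η hη).1)
    (fun η => norm_fderiv_translatedPolar_angular_le hf τ hr _)
  -- Here and in `n4` the derivative is moved onto the weight: `Q₁` is bounded, and `Q₂` is O(sinh
  -- r).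
  have n2 := norm_integral_mul_deriv_le hab (hasDerivAt_slice hW₂ τ) hQ₁ (hslice' hW₂) hQ₁'c
    (fun η hη => (hK₄ τ hτ η hη).1) (fun η hη => (hK₄ τ hτ η hη).2)
    (fun η _ => norm_radialPart_le hf τ hr _)
  have n4 := norm_integral_mul_deriv_le hab (hasDerivAt_slice hW₁ τ) hQ₂ (hslice' hW₁) hQ₂'c
    (fun η hη => (hK₃ τ hτ η hη).1) (fun η hη => (hK₃ τ hτ η hη).2)
    (fun η _ => norm_fderiv_translatedPolar_angular_le hf τ hr _)
  have hexp : Real.exp (-r) ≤ 1 := Real.exp_le_one_iff.mpr (by linarith)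
  rw [norm_mul, norm_mul, norm_cexp_neg_mul hs, Complex.norm_real, Real.norm_of_nonneg hsr.le,
    mul_assoc, mul_comm]
  refine mul_le_mul_of_nonneg_right ?_ (Real.exp_nonneg _)
  refine (mul_le_mul_of_nonneg_left (norm_add_le _ _) hsr.le).trans ?_
  rw [norm_mul, norm_mul, norm_neg, Complex.norm_real, Complex.norm_real,
    Real.norm_of_nonneg (by positivity), Real.norm_of_nonneg (by positivity), mul_add]
  refine add_le_add ?_ ?_
  · rw [← mul_assoc, mul_div_cancel₀ _ hsr.ne']
    refine (mul_le_of_le_one_left (norm_nonneg _) hexp).trans ?_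
    exact (norm_add_le _ _).trans (add_le_add n1 n2)
  · have h1 := (norm_sub_le _ _).trans (add_le_add n3 n4)
    have h2 : Real.sinh r * ((Real.sinh r ^ 2)⁻¹) = (Real.sinh r)⁻¹ := by
      field_simp
    rw [← mul_assoc, h2, inv_mul_le_iff₀ hsr]
    exact h1.trans_eq (by ring)
/-- Arc integrals of `e^{-s r} (∂f/∂r + s f)` are asymptotically equivariant under translations. -/
lemma tendsto_integral_flow_sub {s : ℂ} (hs : s.re = 1 / 2) {C : ℝ} {f : ℂ → ℂ}
    (hf : IsBoundedEigenfunction s C f) {v : ℝ → ℂ} (hv : ContDiff ℝ 1 v) {a b : ℝ} (hab : a ≤ b)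
    {t : ℝ} (ht : 0 ≤ t) :
    Tendsto (fun r : ℝ =>
      (∫ η in a..b, v η * (flowFactor s t η * (Complex.exp (-s * r)
        * radialPart s f (t, r, flowAngle t η) * (Real.sinh r : ℝ))))
      - ∫ η in a..b, v η * (Complex.exp (-s * r) * radialPart s f (0, r, η) * (Real.sinh r : ℝ)))
      atTop (𝓝 0) := by
  obtain ⟨M, hM⟩ := exists_norm_integral_flowIntegrandDeriv_le hs hf hv hab ht
  have hlim : Tendsto (fun r : ℝ => M * Real.exp (-(1 / 2) * r) * (t - 0)) atTop (𝓝 0) := by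
    have h1 : Tendsto (fun r : ℝ => Real.exp (-(1 / 2) * r)) atTop (𝓝 0) :=
      Real.tendsto_exp_atBot.comp (tendsto_id.const_mul_atTop_of_neg (by norm_num))
    simpa using (h1.const_mul M).mul_const (t - 0)
  refine squeeze_zero_norm' ?_ hlim
  filter_upwards [eventually_gt_atTop (0 : ℝ)] with r hr
  -- Mean value inequality in `τ` on [0, t]; at `τ = 0` the flow is the identity and the weight is
  -- 1.
  have h := norm_image_sub_le_of_norm_deriv_le_segment' 
    (fun τ _ => (hasDerivAt_integral_flow hf.contDiffOn hv.continuous a b r τ).hasDerivWithinAt)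
    (fun τ hτ => hM r hr τ (Ico_subset_Icc_self hτ)) t (right_mem_Icc.mpr ht)
  simpa only [flowFactor_zero, flowAngle_zero, one_mul] using h

/-! ### Piecewise `C¹` functions on the circle -/

/-- The derivative is extended by its end values and integrated. A weight that is C¹ on the whole
line makes two-sided derivatives available at the ends of the arc. -/
lemma exists_contDiff_extension {φ : ℝ → ℂ} {a b : ℝ} (hab : a < b)
    (hφ : ContDiffOn ℝ 1 φ (Icc a b)) : ∃ v : ℝ → ℂ, ContDiff ℝ 1 v ∧ EqOn v φ (Icc a b) := by
  have hd : ContinuousOn (derivWithin φ (Icc a b)) (Icc a b) :=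
    hφ.continuousOn_derivWithin (uniqueDiffOn_Icc hab) (by norm_num)
  let g : ℝ → ℂ := IccExtend hab.le ((Icc a b).domRestrict (derivWithin φ (Icc a b)))
  have hg : Continuous g := hd.domRestrict.Icc_extend'
  have hv : ∀ x, HasDerivAt (fun x => φ a + ∫ y in a..x, g y) (g x) x := fun x =>
    (hg.integral_hasStrictDerivAt a x).hasDerivAt.const_add (φ a)
  refine ⟨fun x => φ a + ∫ y in a..x, g y, ?_, fun x hx => ?_⟩
  · rw [contDiff_one_iff_deriv]
    refine ⟨fun x => (hv x).differentiableAt, ?_⟩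
    have : deriv (fun x => φ a + ∫ y in a..x, g y) = g := funext fun x => (hv x).deriv
    rwa [this]
  · have h := intervalIntegral.integral_eq_sub_of_hasDerivAt_of_le (f := φ) (f' := g) hx.1
      (hφ.continuousOn.mono (Icc_subset_Icc_right hx.2)) (fun y hy => ?_) (hg.intervalIntegrable a x)
    · simp only [h]
      ring
    · have hy' : y ∈ Ioo a b := ⟨hy.1, hy.2.trans_le hx.2⟩
      have hgy : g y = derivWithin φ (Icc a b) y := by
        simp only [g, IccExtend_of_mem hab.le _ (Ioo_subset_Icc_self hy'), domRestrict_apply]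
      rw [hgy]
      exact ((hφ.differentiableOn (by norm_num)) y (Ioo_subset_Icc_self hy')).hasDerivWithinAt.hasDerivAt
        (Icc_mem_nhds hy'.1 hy'.2)

/-- A proper connected subset misses a point `p`; cutting the circle at `p` gives a continuous
angle, and the image of the set is an interval with ends `a` and `b`. Membership at the end points
is left open, since they have measure zero. -/
lemma exists_arc_of_isPreconnected {J : Set Circle} (hJ : IsPreconnected J) :
    ∃ a b : ℝ, a ≤ b ∧ b ≤ a + 2 * Real.pi ∧ (∀ θ ∈ Ioo a b, Circle.exp θ ∈ J)
      ∧ ∀ θ ∈ Ioo b (a + 2 * Real.pi), Circle.exp θ ∉ J := by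
  have hpi := Real.pi_pos
  rcases J.eq_empty_or_nonempty with rfl | hne
  · exact ⟨0, 0, le_rfl, by linarith, by simp, by simp⟩
  by_cases huniv : J = univ
  · subst huniv
    exact ⟨0, 2 * Real.pi, by linarith, by linarith, by simp, by simp⟩
  obtain ⟨p, hp⟩ := (ne_univ_iff_exists_notMem J).mp huniv
  -- The shift by `κ` places the discontinuity of the argument exactly at `p`.
  set κ : ℝ := Complex.arg p + Real.pi with hκ
  let w : Circle → Circle := fun ξ => ξ * (Circle.exp κ)⁻¹
  let L : Circle → ℝ := fun ξ => κ + Complex.arg (w ξ : ℂ)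
  have hLexp : ∀ ξ, Circle.exp (L ξ) = ξ := fun ξ => by
    simp only [L, Circle.exp_add, Circle.exp_arg, w]
    rw [mul_comm, inv_mul_cancel_right]
  have harg : ∀ ξ ∈ J, Complex.arg (w ξ : ℂ) ≠ Real.pi := fun ξ hξ h => by
    apply hp
    have h1 := hLexp ξ
    simp only [L, h, hκ] at h1
    rw [add_assoc, ← two_mul, Circle.exp_add_two_pi, Circle.exp_arg] at h1
    rwa [h1]
  have hLc : ContinuousOn L J := by
    refine continuousOn_const.add fun ξ hξ => ?_
    have h1 : (w ξ : ℂ) ∈ Complex.slitPlane :=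
      Complex.mem_slitPlane_iff_arg.mpr ⟨harg ξ hξ, (w ξ).coe_ne_zero⟩
    have h2 : Continuous fun ξ => (w ξ : ℂ) := by
      have : Continuous w := continuous_mul_const _
      exact continuous_subtype_val.comp this
    exact ((Complex.continuousAt_arg h1).comp (f := fun ξ => (w ξ : ℂ))
      h2.continuousAt).continuousWithinAt
  have hlow : ∀ ξ, κ - Real.pi < L ξ := fun ξ => by
    have := Complex.neg_pi_lt_arg (w ξ : ℂ)
    simp only [L]; linarith
  have hupp : ∀ ξ, L ξ ≤ κ + Real.pi := fun ξ => by
    have := Complex.arg_le_pi (w ξ : ℂ)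
    simp only [L]; linarith
  have hord := (hJ.image L hLc).ordConnected
  have hbb : BddBelow (L '' J) := ⟨κ - Real.pi, by rintro _ ⟨ξ, -, rfl⟩; exact (hlow ξ).le⟩
  have hba : BddAbove (L '' J) := ⟨κ + Real.pi, by rintro _ ⟨ξ, -, rfl⟩; exact hupp ξ⟩
  have hne' := hne.image L
  refine ⟨sInf (L '' J), sSup (L '' J), csInf_le_csSup hne' hbb hba, ?_, fun θ hθ => ?_,
    fun θ hθ hmem => ?_⟩
  · have h1 : sSup (L '' J) ≤ κ + Real.pi :=
      csSup_le hne' (by rintro _ ⟨ξ, -, rfl⟩; exact hupp ξ)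
    have h2 : κ - Real.pi ≤ sInf (L '' J) :=
      le_csInf hne' (by rintro _ ⟨ξ, -, rfl⟩; exact (hlow ξ).le)
    linarith
  · obtain ⟨x, hx, hxθ⟩ := exists_lt_of_csInf_lt hne' hθ.1
    obtain ⟨y, hy, hθy⟩ := exists_lt_of_lt_csSup hne' hθ.2
    obtain ⟨ξ, hξ, rfl⟩ := hord.out hx hy ⟨hxθ.le, hθy.le⟩
    rwa [hLexp]
  · have h1 : L (Circle.exp θ) ∈ L '' J := mem_image_of_mem L hmem
    have h2 := csInf_le hbb h1
    have h3 := le_csSup hba h1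
    -- The angle `θ` and the angle in [a, b] of the same point would differ by `2πm` with `0 < m <
    -- 1`.
    obtain ⟨m, hm⟩ := Circle.exp_eq_exp.mp (hLexp (Circle.exp θ)).symm
    have h4 : (0 : ℝ) < m * (2 * Real.pi) := by linarith [hθ.1]
    have h5 : m * (2 * Real.pi) < 1 * (2 * Real.pi) := by linarith [hθ.2]
    have h6 : (0 : ℝ) < m := pos_of_mul_pos_left h4 (by positivity)
    have h7 : (m : ℝ) < 1 := lt_of_mul_lt_mul_right h5 (by positivity)
    have h8 : 0 < m := by exact_mod_cast h6
    have h9 : m < 1 := by exact_mod_cast h7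
    omega

/-- Functions on the circle supported on an arc, `C¹` up to the end points of the arc. -/
def IsArcC1 (u : Circle → ℂ) : Prop :=
  ∃ J : Set Circle, IsPreconnected J ∧ ∃ ψ : Circle → ℂ,
    ContMDiffOn (𝓡 1) 𝓘(ℝ, ℂ) 1 ψ (closure J) ∧ u = J.indicator ψ

lemma IsArcC1.exists_lift {u : Circle → ℂ} (hu : IsArcC1 u) :
    ∃ a b : ℝ, ∃ v : ℝ → ℂ, a ≤ b ∧ b ≤ a + 2 * Real.pi ∧ ContDiff ℝ 1 v
      ∧ (∀ θ ∈ Ioo a b, u (Circle.exp θ) = v θ)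
      ∧ ∀ θ ∈ Ioo b (a + 2 * Real.pi), u (Circle.exp θ) = 0 := by
  obtain ⟨J, hJ, ψ, hψ, rfl⟩ := hu
  obtain ⟨a, b, hab, hba, hin, hout⟩ := exists_arc_of_isPreconnected hJ
  rcases hab.eq_or_lt with rfl | hlt
  · exact ⟨a, a, 0, hab, hba, contDiff_const, by simp,
      fun θ hθ => indicator_of_notMem (hout θ hθ) _⟩
  have hmaps : MapsTo Circle.exp (Icc a b) (closure J) := by
    rw [← closure_Ioo hlt.ne]
    exact MapsTo.closure hin Circle.exp.continuous
  have hc : ContDiffOn ℝ 1 (ψ ∘ Circle.exp) (Icc a b) :=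
    contMDiffOn_iff_contDiffOn.mp (hψ.comp contMDiff_circleExp.contMDiffOn hmaps)
  obtain ⟨v, hv, hvψ⟩ := exists_contDiff_extension hlt hc
  refine ⟨a, b, v, hab, hba, hv, fun θ hθ => ?_, fun θ hθ => indicator_of_notMem (hout θ hθ) _⟩
  rw [indicator_of_mem (hin θ hθ), hvψ (Ioo_subset_Icc_self hθ)]
  rfl

/-- By periodicity the period may start at `a`, where the support is the single interval from `a` to
`b`. -/
lemma intervalIntegral_arc {u : Circle → ℂ} {a b : ℝ} {v : ℝ → ℂ} (hab : a ≤ b)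
    (hba : b ≤ a + 2 * Real.pi) (hv : Continuous v) (hin : ∀ θ ∈ Ioo a b, u (Circle.exp θ) = v θ)
    (hout : ∀ θ ∈ Ioo b (a + 2 * Real.pi), u (Circle.exp θ) = 0) {G : ℝ → ℂ} (hG : Continuous G)
    (hGp : Function.Periodic G (2 * Real.pi)) :
    IntervalIntegrable (fun θ => u (Circle.exp θ) * G θ) MeasureTheory.volume 0 (2 * Real.pi) ∧
      ∫ θ in (0 : ℝ)..(2 * Real.pi), u (Circle.exp θ) * G θ = ∫ θ in a..b, v θ * G θ := by
  have hper : Function.Periodic (fun θ => u (Circle.exp θ) * G θ) (2 * Real.pi) := fun θ => by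
    simp only [Circle.exp_add_two_pi, hGp θ]
  have e1 : EqOn (fun θ => v θ * G θ) (fun θ => u (Circle.exp θ) * G θ) (Ioo a b) :=
    fun θ hθ => by simp only [hin θ hθ]
  have e2 : EqOn (fun _ => (0 : ℂ)) (fun θ => u (Circle.exp θ) * G θ) (Ioo b (a + 2 * Real.pi)) :=
    fun θ hθ => by simp only [hout θ hθ, zero_mul]
  have i1 : IntervalIntegrable (fun θ => u (Circle.exp θ) * G θ) MeasureTheory.volume a b :=
    ((hv.mul hG).intervalIntegrable a b).congr_uIoo (by rwa [uIoo_of_le hab])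
  have i2 : IntervalIntegrable (fun θ => u (Circle.exp θ) * G θ) MeasureTheory.volume b
      (a + 2 * Real.pi) :=
    (intervalIntegrable_const (c := (0 : ℂ))).congr_uIoo (by rwa [uIoo_of_le hba])
  refine ⟨hper.intervalIntegrable Real.two_pi_pos.ne' (i1.trans i2) _ _, ?_⟩
  have h := hper.intervalIntegral_add_eq 0 a
  rw [zero_add] at h
  rw [h, ← intervalIntegral.integral_add_adjacent_intervals i1 i2,
    ← intervalIntegral.integral_congr_uIoo (by rwa [uIoo_of_le hab] : EqOn _ _ (uIoo a b)),
    ← intervalIntegral.integral_congr_uIoo (by rwa [uIoo_of_le hba] : EqOn _ _ (uIoo b (a + 2 * Real.pi)))]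
  simp

/-! ### Densities of order s at infinity -/

/-- The action of `g` on densities of order `s` at infinity. -/
def pushDensity (s : ℂ) (g : SU11) (u : Circle → ℂ) (ξ : Circle) : ℂ :=
  u (g⁻¹ • ξ) / ((boundaryDeriv g (g⁻¹ • ξ) : ℝ) : ℂ) ^ s

lemma IsArcC1.pushDensity {u : Circle → ℂ} (hu : IsArcC1 u) (s : ℂ) (g : SU11) :
    IsArcC1 (pushDensity s g u) := by
  obtain ⟨J, hJ, ψ, hψ, rfl⟩ := hu
  have hgc := contMDiff_smul g
  have hg := contMDiff_smul g⁻¹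
  refine ⟨(fun ξ => g • ξ) '' J, hJ.image _ hgc.continuous.continuousOn,
    Hyperbolic.pushDensity s g ψ, ?_, ?_⟩
  · have hmaps : MapsTo (fun ξ : Circle => g⁻¹ • ξ) (closure ((fun ξ => g • ξ) '' J)) (closure J) := by
      refine MapsTo.closure ?_ hg.continuous
      rintro _ ⟨η, hη, rfl⟩
      simpa using hη
    have h1 := hψ.comp hg.contMDiffOn hmaps
    have h2 := (contMDiff_boundaryDeriv_cpow g (-s)).comp hg
    have h3 : ContDiff ℝ 1 (fun w : ℂ × ℂ => w.1 * w.2) := by fun_prop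
    refine (h3.contMDiff.comp_contMDiffOn (h1.prodMk_space h2.contMDiffOn)).congr fun ξ _ => ?_
    simp [Hyperbolic.pushDensity, Complex.cpow_neg, div_eq_mul_inv]
  · funext ξ
    have hiff : ξ ∈ (fun ξ => g • ξ) '' J ↔ g⁻¹ • ξ ∈ J := by
      constructor
      · rintro ⟨η, hη, rfl⟩
        simpa using hη
      · exact fun h => ⟨g⁻¹ • ξ, h, smul_inv_smul g ξ⟩
    by_cases h : g⁻¹ • ξ ∈ J
    · rw [indicator_of_mem (hiff.mpr h), Hyperbolic.pushDensity, indicator_of_mem h]; rfl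
    · rw [indicator_of_notMem (fun h' => h (hiff.mp h')), Hyperbolic.pushDensity,
        indicator_of_notMem h, zero_div]

lemma boundaryDeriv_mul (g h : SU11) (ξ : Circle) :
    boundaryDeriv (g * h) ξ = boundaryDeriv g (h • ξ) * boundaryDeriv h ξ := by
  rw [boundaryDeriv_eq, boundaryDeriv_eq, boundaryDeriv_eq, ← mul_inv, ← Complex.normSq_mul,
    coe_smul]
  congr 2
  have h1 := denom_ne_zero h ξ
  simp only [mobius, Subgroup.coe_mul, Matrix.SpecialLinearGroup.coe_mul, Matrix.mul_apply,
    Fin.sum_univ_two]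
  field_simp
  ring

/-- The boundary derivative is a multiplicative cocycle with positive values, so its complex powers
multiply too. -/
lemma pushDensity_mul (s : ℂ) (g h : SU11) (u : Circle → ℂ) :
    pushDensity s (g * h) u = pushDensity s g (pushDensity s h u) := by
  funext ξ
  simp only [pushDensity, mul_inv_rev, mul_smul]
  rw [boundaryDeriv_mul, smul_inv_smul, Complex.ofReal_mul,
    Complex.mul_cpow_ofReal_nonneg (boundaryDeriv_pos _ _).le (boundaryDeriv_pos _ _).le,
    div_div, mul_comm (_ ^ s)]

/-! ### Equivariance of the Helgason integrals -/

lemma helgasonIntegral_comp_translation (s : ℂ) {f : ℂ → ℂ}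
    (hf : ContDiffOn ℝ 2 f (Metric.ball 0 1)) (u : Circle → ℂ) (τ r : ℝ) :
    helgasonIntegral s (fun z => f (mobius (translation τ) z)) u r
      = (normalizingConstant s)⁻¹ * ∫ θ in (0 : ℝ)..(2 * Real.pi), u (Circle.exp θ) *
        (Complex.exp (-s * r) * radialPart s f (τ, r, θ) * (Real.sinh r : ℝ)) := by
  unfold helgasonIntegral
  congr 1
  refine intervalIntegral.integral_congr fun θ _ => ?_
  have h : deriv (fun ρ : ℝ => f (mobius (translation τ) (polar ρ θ))) r
      = fderiv ℝ (translatedPolar f) (τ, r, θ) (0, 1, 0) :=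
    (hasDerivAt_slice₂ (differentiable_translatedPolar hf) τ r θ).deriv
  simp only [h]
  rfl

lemma mobius_translation_zero (z : ℂ) : mobius (translation 0) z = z := by
  simp [mobius_translation]

lemma helgasonIntegral_eq (s : ℂ) {f : ℂ → ℂ} (hf : ContDiffOn ℝ 2 f (Metric.ball 0 1))
    (u : Circle → ℂ) (r : ℝ) :
    helgasonIntegral s f u r
      = (normalizingConstant s)⁻¹ * ∫ θ in (0 : ℝ)..(2 * Real.pi), u (Circle.exp θ) *
        (Complex.exp (-s * r) * radialPart s f (0, r, θ) * (Real.sinh r : ℝ)) := by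
  rw [← helgasonIntegral_comp_translation s hf u 0 r]
  simp only [mobius_translation_zero]

lemma helgasonIntegral_congr (s : ℂ) {f₁ f₂ : ℂ → ℂ}
    (h : EqOn f₁ f₂ (Metric.ball 0 1)) (u : Circle → ℂ) (r : ℝ) :
    helgasonIntegral s f₁ u r = helgasonIntegral s f₂ u r := by
  have h' : ∀ ρ θ, f₁ (polar ρ θ) = f₂ (polar ρ θ) := fun ρ θ => h (polar_mem_ball ρ θ)
  simp only [helgasonIntegral, h']

lemma polar_add_two_pi (r θ : ℝ) : polar r (θ + 2 * Real.pi) = polar r θ := by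
  rw [polar, polar, Circle.exp_add_two_pi]

lemma translatedPolar_add_two_pi (f : ℂ → ℂ) (τ r θ : ℝ) :
    translatedPolar f (τ, r, θ + 2 * Real.pi) = translatedPolar f (τ, r, θ) := by
  simp only [translatedPolar, polar_add_two_pi]

lemma radialPart_add_two_pi (s : ℂ) {f : ℂ → ℂ} (hf : ContDiffOn ℝ 2 f (Metric.ball 0 1))
    (τ r θ : ℝ) : radialPart s f (τ, r, θ + 2 * Real.pi) = radialPart s f (τ, r, θ) := by
  have hd := differentiable_translatedPolar hf
  have h := hasDerivAt_slice₂ hd τ r (θ + 2 * Real.pi)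
  simp only [translatedPolar_add_two_pi] at h
  rw [radialPart, radialPart, h.unique (hasDerivAt_slice₂ hd τ r θ), translatedPolar_add_two_pi]

lemma continuous_helgasonDensity (s : ℂ) {f : ℂ → ℂ} (hf : ContDiffOn ℝ 2 f (Metric.ball 0 1))
    (τ r : ℝ) : Continuous fun θ : ℝ =>
      Complex.exp (-s * r) * radialPart s f (τ, r, θ) * (Real.sinh r : ℝ) := by
  have := (differentiable_radialPart (s := s) hf).continuous
  fun_prop

lemma periodic_helgasonDensity (s : ℂ) {f : ℂ → ℂ} (hf : ContDiffOn ℝ 2 f (Metric.ball 0 1))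
    (τ r : ℝ) : Function.Periodic (fun θ : ℝ =>
      Complex.exp (-s * r) * radialPart s f (τ, r, θ) * (Real.sinh r : ℝ)) (2 * Real.pi) :=
  fun θ => by simp only [radialPart_add_two_pi s hf]

lemma exists_tendsto_helgasonIntegral {s : ℂ} (hs : s.re = 1 / 2) {C : ℝ} {f : ℂ → ℂ}
    (hf : IsBoundedEigenfunction s C f) {u : Circle → ℂ} (hu : IsArcC1 u) :
    ∃ l : ℂ, Tendsto (helgasonIntegral s f u) atTop (𝓝 l) := by
  obtain ⟨a, b, v, hab, hba, hv, hin, hout⟩ := hu.exists_lift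
  obtain ⟨l, hl⟩ := exists_tendsto_integral_radialPart hs hf hv hab
  refine ⟨_, (hl.const_mul (normalizingConstant s)⁻¹).congr fun r => ?_⟩
  rw [helgasonIntegral_eq s hf.contDiffOn, (intervalIntegral_arc hab hba hv.continuous hin hout
    (continuous_helgasonDensity s hf.contDiffOn 0 r)
    (periodic_helgasonDensity s hf.contDiffOn 0 r)).2]

lemma helgasonIntegral_sum {s : ℂ} {f : ℂ → ℂ} (hf : ContDiffOn ℝ 2 f (Metric.ball 0 1))
    {ι : Type*} (A : Finset ι) {u : ι → Circle → ℂ} (hu : ∀ i ∈ A, IsArcC1 (u i)) (r : ℝ) :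
    helgasonIntegral s f (fun ξ => ∑ i ∈ A, u i ξ) r = ∑ i ∈ A, helgasonIntegral s f (u i) r := by
  simp only [helgasonIntegral_eq s hf, Finset.sum_mul, ← Finset.mul_sum]
  rw [intervalIntegral.integral_finsetSum]
  intro i hi
  obtain ⟨a, b, v, hab, hba, hv, hin, hout⟩ := (hu i hi).exists_lift
  exact (intervalIntegral_arc hab hba hv.continuous hin hout (continuous_helgasonDensity s hf 0 r)
    (periodic_helgasonDensity s hf 0 r)).1

/-- The Helgason integrals of bounded eigenfunctions are asymptotically equivariant under `g`. -/
def IsEquivariant (s : ℂ) (g : SU11) : Prop :=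
  ∀ (C : ℝ) (f : ℂ → ℂ), IsBoundedEigenfunction s C f → ∀ u : Circle → ℂ, IsArcC1 u →
    Tendsto (fun r => helgasonIntegral s (fun z => f (mobius g⁻¹ z)) (pushDensity s g u) r
      - helgasonIntegral s f u r) atTop (𝓝 0)

/-- The property of `g` is used for the function `f ∘ h⁻¹`, which is why `IsEquivariant` quantifies
over all bounded eigenfunctions and not only over automorphic ones. -/
lemma IsEquivariant.mul {s : ℂ} {g h : SU11} (hg : IsEquivariant s g) (hh : IsEquivariant s h) :
    IsEquivariant s (g * h) := by
  intro C f hf u hu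
  have h1 := hg C _ (hf.comp_mobius h⁻¹) _ (hu.pushDensity s h)
  have h2 := hh C f hf u hu
  have h3 := h1.add h2
  rw [add_zero] at h3
  refine h3.congr fun r => ?_
  have h4 : EqOn (fun z => f (mobius (g * h)⁻¹ z)) (fun z => f (mobius h⁻¹ (mobius g⁻¹ z)))
      (Metric.ball 0 1) := fun z hz => by
    simp only [mul_inv_rev, mobius_mul _ _ hz]
  rw [helgasonIntegral_congr s h4, pushDensity_mul]
  ring

lemma translation_inv (τ : ℝ) : (translation τ)⁻¹ = translation (-τ) := by
  apply Subtype.ext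
  apply Subtype.ext
  have h : (((translation τ)⁻¹ : SU11).1 : Matrix (Fin 2) (Fin 2) ℂ)
      = (translation τ).1.1.adjugate := by
    rw [Subgroup.coe_inv, Matrix.SpecialLinearGroup.coe_inv]
  rw [h]
  simp [translation, Matrix.adjugate_fin_two, neg_div]

lemma denom_translation_inv (t η : ℝ) :
    ((translation t)⁻¹).1 1 0 * (Circle.exp η : ℂ) + ((translation t)⁻¹).1 1 1
      = ((Real.cosh (t / 2) - Real.sinh (t / 2) * Real.cos η : ℝ) : ℂ)
        + ((-(Real.sinh (t / 2) * Real.sin η) : ℝ) : ℂ) * Complex.I := by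
  have h1 : ((translation t)⁻¹).1 1 0 = -((Real.sinh (t / 2) : ℝ) : ℂ) := by
    rw [translation_inv]; simp [translation, neg_div]
  have h2 : ((translation t)⁻¹).1 1 1 = ((Real.cosh (t / 2) : ℝ) : ℂ) := by
    rw [translation_inv]; simp [translation, neg_div]
  rw [h1, h2, Circle.coe_exp, Complex.exp_mul_I]
  push_cast
  ring

lemma normSq_denom_translation_inv (t η : ℝ) :
    Complex.normSq (((translation t)⁻¹).1 1 0 * (Circle.exp η : ℂ) + ((translation t)⁻¹).1 1 1)
      = flowDenom t η := by
  rw [denom_translation_inv, Complex.normSq_add_mul_I, flowDenom_eq, neg_sq]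

lemma boundaryDeriv_translation_inv (t η : ℝ) :
    boundaryDeriv (translation t)⁻¹ (Circle.exp η) = (flowDenom t η)⁻¹ := by
  rw [boundaryDeriv_eq, normSq_denom_translation_inv]

/-- On the circle `num_eq` gives g z = z · conj D / D with D = c z + d. Here D = x - i y with x > 0,
so the quotient is exp(2 i arctan(y / x)). -/
lemma translation_inv_smul_exp (t η : ℝ) :
    (translation t)⁻¹ • Circle.exp η = Circle.exp (flowAngle t η) := by
  have hx := cosh_sub_sinh_mul_cos_pos (t / 2) η
  apply Circle.ext
  rw [coe_smul, mobius, num_eq]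
  have hd := denom_ne_zero (translation t)⁻¹ (Circle.exp η)
  have hφ : (Circle.exp (flowAngle t η) : ℂ) = Circle.exp η *
      ((Real.cos (2 * Real.arctan (Real.sinh (t / 2) * Real.sin η
        / (Real.cosh (t / 2) - Real.sinh (t / 2) * Real.cos η))) : ℝ)
      + (Real.sin (2 * Real.arctan (Real.sinh (t / 2) * Real.sin η
        / (Real.cosh (t / 2) - Real.sinh (t / 2) * Real.cos η))) : ℝ) * Complex.I) := by
    rw [flowAngle, Circle.exp_add, Circle.coe_mul, Circle.coe_exp (2 * _), Complex.exp_mul_I]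
    push_cast
    rfl
  rw [hφ, cos_two_mul_arctan_div _ hx.ne', sin_two_mul_arctan_div _ hx.ne', mul_div_assoc]
  congr 1
  rw [div_eq_iff hd, denom_translation_inv]
  generalize Real.cosh (t / 2) - Real.sinh (t / 2) * Real.cos η = x at hx
  generalize Real.sinh (t / 2) * Real.sin η = y
  have hxy : ((x : ℂ) ^ 2 + (y : ℂ) ^ 2) ≠ 0 := by
    have : x ^ 2 + y ^ 2 ≠ 0 := by positivity
    exact_mod_cast this
  simp only [map_add, map_mul, Complex.conj_ofReal, Complex.conj_I]
  push_cast
  field_simp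
  linear_combination (2 * (x : ℂ) * y ^ 2) * Complex.I_sq

lemma strictMono_flowAngle (t : ℝ) : StrictMono (flowAngle t) :=
  strictMono_of_deriv_pos fun η => by
    rw [(hasDerivAt_flowAngle t η).deriv]
    exact inv_pos.mpr (flowDenom_pos t η)

/-- Change of variables for a monotone C¹ bijection of the period. No regularity of `K` is required,
so densities that jump at the ends of an arc are covered. -/
lemma intervalIntegral_comp_flowAngle (t : ℝ) (K : ℝ → ℂ) :
    ∫ θ in (0 : ℝ)..(2 * Real.pi), K θ
      = ∫ η in (0 : ℝ)..(2 * Real.pi), ((flowDenom t η)⁻¹ : ℝ) * K (flowAngle t η) := by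
  have h0 := flowAngle_apply_zero t
  have h2 : flowAngle t (2 * Real.pi) = 2 * Real.pi := by
    have := flowAngle_add_two_pi t 0
    rwa [h0, zero_add] at this
  have himg : flowAngle t '' Icc 0 (2 * Real.pi) = Icc 0 (2 * Real.pi) := by
    apply Subset.antisymm
    · rintro _ ⟨η, hη, rfl⟩
      exact ⟨h0 ▸ (strictMono_flowAngle t).monotone hη.1, h2 ▸ (strictMono_flowAngle t).monotone hη.2⟩
    · have := intermediate_value_Icc Real.two_pi_pos.le
        (continuous_slice contDiff_flowAngle.continuous t).continuousOn
      rwa [h0, h2] at this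
  rw [intervalIntegral.integral_of_le Real.two_pi_pos.le,
    intervalIntegral.integral_of_le Real.two_pi_pos.le, ← MeasureTheory.integral_Icc_eq_integral_Ioc,
    ← MeasureTheory.integral_Icc_eq_integral_Ioc]
  conv_lhs => rw [← himg]
  rw [MeasureTheory.integral_image_eq_integral_abs_deriv_smul measurableSet_Icc
    (fun η _ => (hasDerivAt_flowAngle t η).hasDerivWithinAt) (strictMono_flowAngle t).injective.injOn]
  refine MeasureTheory.integral_congr_ae (Eventually.of_forall fun η => ?_)
  simp only [abs_of_pos (inv_pos.mpr (flowDenom_pos t η)), Complex.real_smul]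

lemma isEquivariant_translation_inv {s : ℂ} (hs : s.re = 1 / 2) {t : ℝ} (ht : 0 ≤ t) :
    IsEquivariant s (translation t)⁻¹ := by
  intro C f hf u hu
  have hf₂ := hf.contDiffOn
  obtain ⟨a, b, v, hab, hba, hv, hin, hout⟩ := hu.exists_lift
  have h := (tendsto_integral_flow_sub hs hf hv hab ht).const_mul (normalizingConstant s)⁻¹
  rw [mul_zero] at h
  refine h.congr fun r => ?_
  have hG := continuous_helgasonDensity s hf₂ t r
  have hE : Continuous (flowFactor s t) := continuous_slice (contDiff_flowFactor s).continuous t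
  have hA : Continuous (flowAngle t) := continuous_slice contDiff_flowAngle.continuous t
  have harc := (intervalIntegral_arc hab hba hv.continuous hin hout (G := fun η => flowFactor s t η
    * (Complex.exp (-s * r) * radialPart s f (t, r, flowAngle t η) * (Real.sinh r : ℝ)))
    (hE.mul (hG.comp hA)) fun η => by
      simp only [flowFactor, flowDenom_add_two_pi, flowAngle_add_two_pi,
        radialPart_add_two_pi s hf₂]).2
  rw [inv_inv, helgasonIntegral_comp_translation s hf₂, helgasonIntegral_eq s hf₂,
    (intervalIntegral_arc hab hba hv.continuous hin hout (continuous_helgasonDensity s hf₂ 0 r)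
    (periodic_helgasonDensity s hf₂ 0 r)).2, mul_sub, intervalIntegral_comp_flowAngle t,
    ← harc]
  congr 2
  refine intervalIntegral.integral_congr fun η _ => ?_
  have hN := flowDenom_pos t η
  have hN' : ((flowDenom t η : ℝ) : ℂ) ≠ 0 := by exact_mod_cast hN.ne'
  -- The Jacobian |g'| of the substitution and the density factor |g'|^{-s} combine to |g'|^{1-s},
  -- the weight `flowFactor`.
  have hF : flowFactor s t η = (((flowDenom t η)⁻¹ : ℝ) : ℂ)
      / ((((flowDenom t η)⁻¹ : ℝ) : ℂ) ^ s) := by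
    rw [Complex.ofReal_inv, Complex.cpow_def_of_ne_zero (inv_ne_zero hN'), ← Complex.ofReal_inv,
      ← Complex.ofReal_log (inv_pos.mpr hN).le, Real.log_inv, flowFactor, div_eq_mul_inv,
      ← Complex.exp_neg]
    nth_rewrite 2 [← Real.exp_log hN]
    rw [← Real.exp_neg, Complex.ofReal_exp, ← Complex.exp_add]
    congr 1
    push_cast
    ring
  simp only [pushDensity, ← translation_inv_smul_exp, inv_smul_smul, boundaryDeriv_translation_inv,
    hF]
  ring

/-! ### Rotations and the Cartan decomposition -/

/-- The rotation by the angle `φ`. -/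
def rotation (φ : ℝ) : SU11 :=
  ⟨⟨!![(Circle.exp (φ / 2) : ℂ), 0; 0, (Circle.exp (-(φ / 2)) : ℂ)], by
      rw [Matrix.det_fin_two_of, ← Circle.coe_mul, ← Circle.exp_add]
      simp⟩, by
    refine ⟨?_, ?_⟩
    · change (Circle.exp (-(φ / 2)) : ℂ) = conj (Circle.exp (φ / 2) : ℂ)
      rw [Circle.exp_neg, Circle.coe_inv_eq_conj]
    · change (0 : ℂ) = conj (0 : ℂ)
      rw [map_zero]⟩

lemma rotation_inv (φ : ℝ) : (rotation φ)⁻¹ = rotation (-φ) := by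
  apply Subtype.ext
  apply Subtype.ext
  have h : (((rotation φ)⁻¹ : SU11).1 : Matrix (Fin 2) (Fin 2) ℂ)
      = (rotation φ).1.1.adjugate := by
    rw [Subgroup.coe_inv, Matrix.SpecialLinearGroup.coe_inv]
  rw [h]
  simp [rotation, Matrix.adjugate_fin_two, neg_div]

lemma mobius_rotation (φ : ℝ) (z : ℂ) : mobius (rotation φ) z = Circle.exp φ * z := by
  have h : (Circle.exp φ : ℂ) = Circle.exp (φ / 2) * Circle.exp (φ / 2) := by
    rw [← Circle.coe_mul, ← Circle.exp_add, add_halves]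
  have h0 := (Circle.exp (φ / 2)).coe_ne_zero
  rw [h]
  simp only [mobius, rotation, Matrix.of_apply, Matrix.cons_val', Matrix.cons_val_zero,
    Matrix.cons_val_one, Circle.exp_neg, Circle.coe_inv]
  simp
  field_simp

lemma rotation_smul_exp (φ θ : ℝ) : rotation φ • Circle.exp θ = Circle.exp (φ + θ) := by
  apply Circle.ext
  rw [coe_smul, mobius_rotation, ← Circle.coe_mul, ← Circle.exp_add]

lemma boundaryDeriv_rotation (φ : ℝ) (ξ : Circle) : boundaryDeriv (rotation φ) ξ = 1 := by
  have h : mobius (rotation φ) = fun z : ℂ => (Circle.exp φ : ℂ) * z := funext (mobius_rotation φ)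
  have hd : HasDerivAt (fun z : ℂ => (Circle.exp φ : ℂ) * z) (Circle.exp φ : ℂ) (ξ : ℂ) := by
    simpa using (hasDerivAt_id (ξ : ℂ)).const_mul (Circle.exp φ : ℂ)
  rw [boundaryDeriv, h, hd.deriv, Circle.norm_coe]

lemma isEquivariant_rotation (s : ℂ) (φ : ℝ) : IsEquivariant s (rotation φ) := by
  intro C f _ u _
  refine tendsto_const_nhds.congr fun r => ?_
  rw [eq_comm, sub_eq_zero]
  let h : ℝ → ℂ := fun θ => u (Circle.exp θ) * (Complex.exp (-s * r) *
      (deriv (fun ρ : ℝ => f (polar ρ θ)) r + s * f (polar r θ)) * (Real.sinh r : ℝ))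
  have hper : Function.Periodic h (2 * Real.pi) := fun θ => by
    simp only [h, Circle.exp_add_two_pi, polar_add_two_pi]
  have hp : ∀ ρ θ, mobius (rotation φ)⁻¹ (polar ρ θ) = polar ρ (θ - φ) := fun ρ θ => by
    rw [rotation_inv, mobius_rotation, polar, polar, sub_eq_neg_add, Circle.exp_add, Circle.coe_mul]
    ring
  unfold helgasonIntegral
  congr 1
  have h1 : ∀ θ, pushDensity s (rotation φ) u (Circle.exp θ) = u (Circle.exp (θ - φ)) := fun θ => by
    simp only [pushDensity, boundaryDeriv_rotation, Complex.ofReal_one, Complex.one_cpow, div_one,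
      rotation_inv, rotation_smul_exp]
    rw [neg_add_eq_sub]
  simp only [hp, h1]
  change ∫ θ in (0 : ℝ)..(2 * Real.pi), h (θ - φ) = ∫ θ in (0 : ℝ)..(2 * Real.pi), h θ
  rw [intervalIntegral.integral_comp_sub_right]
  have := hper.intervalIntegral_add_eq (0 - φ) 0
  rw [zero_add] at this
  rw [← this]
  congr 1
  ring

lemma ext_of_first_row {g h : SU11} (h₀ : g.1 0 0 = h.1 0 0) (h₁ : g.1 0 1 = h.1 0 1) : g = h := by
  apply Subtype.ext
  apply Subtype.ext
  ext i j
  fin_cases i <;> fin_cases j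
  · exact h₀
  · exact h₁
  · exact (g.2.2.trans (congrArg conj h₁)).trans h.2.2.symm
  · exact (g.2.1.trans (congrArg conj h₀)).trans h.2.1.symm

lemma exists_cartan_decomposition (g : SU11) :
    ∃ φ ψ t : ℝ, 0 ≤ t ∧ g = rotation φ * (translation t)⁻¹ * rotation ψ := by
  obtain ⟨a, ha⟩ : ∃ a, a = g.1 0 0 := ⟨_, rfl⟩
  obtain ⟨b, hb⟩ : ∃ b, b = g.1 0 1 := ⟨_, rfl⟩
  -- Half the sum of the two angles must be the argument of `a`, half their difference that of `-b`,
  -- and sinh(t/2) must be |b|. The sign of `b` comes from the inverse of the translation.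
  refine ⟨a.arg + (-b).arg, a.arg - (-b).arg, 2 * Real.arsinh ‖b‖,
    mul_nonneg zero_le_two (Real.arsinh_nonneg_iff.mpr (norm_nonneg _)), ?_⟩
  have hab := normSq_sub g
  rw [← ha, ← hb, Complex.normSq_eq_norm_sq, Complex.normSq_eq_norm_sq] at hab
  have hs : Real.sinh (-(2 * Real.arsinh ‖b‖) / 2) = -‖b‖ := by
    rw [neg_div, mul_div_cancel_left₀ _ two_ne_zero, Real.sinh_neg, Real.sinh_arsinh]
  have hc : Real.cosh (-(2 * Real.arsinh ‖b‖) / 2) = ‖a‖ := by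
    rw [neg_div, mul_div_cancel_left₀ _ two_ne_zero, Real.cosh_neg, Real.cosh_arsinh,
      ← Real.sqrt_sq (norm_nonneg a)]
    congr 1
    linarith
  have he : ∀ φ ψ : ℝ, (rotation φ * (translation (2 * Real.arsinh ‖b‖))⁻¹ * rotation ψ).1 0 0
      = ‖a‖ * (Circle.exp ((φ + ψ) / 2) : ℂ)
      ∧ (rotation φ * (translation (2 * Real.arsinh ‖b‖))⁻¹ * rotation ψ).1 0 1
      = -(‖b‖ * (Circle.exp ((φ - ψ) / 2) : ℂ)) := fun φ ψ => by
    rw [translation_inv, add_div, sub_div, sub_eq_add_neg, Circle.exp_add, Circle.exp_add,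
      Circle.coe_mul, Circle.coe_mul]
    have t0 : (translation (-(2 * Real.arsinh ‖b‖))).1 0 0 = (‖a‖ : ℂ) := congrArg Complex.ofReal hc
    have t1 : (translation (-(2 * Real.arsinh ‖b‖))).1 0 1 = ((-‖b‖ : ℝ) : ℂ) := congrArg Complex.ofReal hs
    have r0 : ∀ φ, (rotation φ).1 0 0 = (Circle.exp (φ / 2) : ℂ) := fun _ => rfl
    have r1 : ∀ φ, (rotation φ).1 0 1 = 0 := fun _ => rfl
    have r2 : ∀ φ, (rotation φ).1 1 0 = 0 := fun _ => rfl
    have r3 : ∀ φ, (rotation φ).1 1 1 = (Circle.exp (-(φ / 2)) : ℂ) := fun _ => rfl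
    simp only [Subgroup.coe_mul, Matrix.SpecialLinearGroup.coe_mul, Matrix.mul_apply,
      Fin.sum_univ_two, r0, r1, r2, r3, t0, t1]
    push_cast
    constructor <;> ring
  refine ext_of_first_row ?_ ?_
  · rw [(he _ _).1, ← ha, add_add_sub_cancel, add_self_div_two, Circle.coe_exp,
      Complex.norm_mul_exp_arg_mul_I]
  · rw [(he _ _).2, ← hb, add_sub_sub_cancel, add_self_div_two, Circle.coe_exp, ← norm_neg b,
      Complex.norm_mul_exp_arg_mul_I, neg_neg]

lemma isEquivariant {s : ℂ} (hs : s.re = 1 / 2) (g : SU11) : IsEquivariant s g := by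
  obtain ⟨φ, ψ, t, ht, rfl⟩ := exists_cartan_decomposition g
  exact ((isEquivariant_rotation s φ).mul (isEquivariant_translation_inv hs ht)).mul
    (isEquivariant_rotation s ψ)

/-! ### The Helgason distribution on piecewise `C¹` functions -/

lemma IsArcC1.intervalIntegrable {u : Circle → ℂ} (hu : IsArcC1 u) (s : ℂ) {f : ℂ → ℂ}
    (hf : ContDiffOn ℝ 2 f (Metric.ball 0 1)) (r : ℝ) :
    IntervalIntegrable (fun θ : ℝ => u (Circle.exp θ) * (Complex.exp (-s * r)
      * radialPart s f (0, r, θ) * (Real.sinh r : ℝ))) MeasureTheory.volume 0 (2 * Real.pi) := by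
  obtain ⟨a, b, v, hab, hba, hv, hin, hout⟩ := hu.exists_lift
  exact (intervalIntegral_arc hab hba hv.continuous hin hout (continuous_helgasonDensity s hf 0 r)
    (periodic_helgasonDensity s hf 0 r)).1

lemma helgasonIntegral_smul (s : ℂ) (f : ℂ → ℂ) (c : ℂ) (u : Circle → ℂ) (r : ℝ) :
    helgasonIntegral s f (fun ξ => c * u ξ) r = c * helgasonIntegral s f u r := by
  unfold helgasonIntegral
  simp only [mul_assoc c]
  rw [intervalIntegral.integral_const_mul, mul_left_comm]

namespace MarkovMap

variable {Γ : Subgroup SU11} (M : MarkovMap Γ)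

lemma isArcC1_component {ψ : Fin M.q → Circle → ℂ} (hψ : ψ ∈ M.PiecewiseC1) (k : Fin M.q) :
    IsArcC1 ((M.I k).indicator (ψ k)) :=
  ⟨M.I k, (M.isConnected k).isPreconnected, ψ k, hψ k, rfl⟩

lemma helgasonIntegral_glue (s : ℂ) {f : ℂ → ℂ} (hf : ContDiffOn ℝ 2 f (Metric.ball 0 1))
    {ψ : Fin M.q → Circle → ℂ} (hψ : ψ ∈ M.PiecewiseC1) (r : ℝ) :
    helgasonIntegral s f (M.glue ψ) r
      = ∑ k, helgasonIntegral s f ((M.I k).indicator (ψ k)) r :=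
  helgasonIntegral_sum hf Finset.univ (fun k _ => M.isArcC1_component hψ k) r

lemma helgasonIntegral_glue_add (s : ℂ) {f : ℂ → ℂ} (hf : ContDiffOn ℝ 2 f (Metric.ball 0 1))
    {ψ φ : Fin M.q → Circle → ℂ} (hψ : ψ ∈ M.PiecewiseC1) (hφ : φ ∈ M.PiecewiseC1) (r : ℝ) :
    helgasonIntegral s f (M.glue (ψ + φ)) r
      = helgasonIntegral s f (M.glue ψ) r + helgasonIntegral s f (M.glue φ) r := by
  rw [M.helgasonIntegral_glue s hf hψ, M.helgasonIntegral_glue s hf hφ,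
    M.helgasonIntegral_glue s hf (M.PiecewiseC1.add_mem hψ hφ), ← Finset.sum_add_distrib]
  refine Finset.sum_congr rfl fun k _ => ?_
  have h1 := (M.isArcC1_component hψ k).intervalIntegrable s hf r
  have h2 := (M.isArcC1_component hφ k).intervalIntegrable s hf r
  rw [helgasonIntegral_eq s hf, helgasonIntegral_eq s hf, helgasonIntegral_eq s hf, ← mul_add,
    ← intervalIntegral.integral_add h1 h2]
  simp only [Pi.add_apply, indicator_add', add_mul]

lemma helgasonIntegral_glue_smul (s : ℂ) (f : ℂ → ℂ) (c : ℂ) (ψ : Fin M.q → Circle → ℂ) (r : ℝ) :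
    helgasonIntegral s f (M.glue (c • ψ)) r = c * helgasonIntegral s f (M.glue ψ) r := by
  rw [← helgasonIntegral_smul]
  congr 1
  funext ξ
  simp only [glue, Finset.mul_sum]
  refine Finset.sum_congr rfl fun k _ => ?_
  by_cases h : ξ ∈ M.I k <;> simp [h]

/-- The Helgason distribution of a bounded eigenfunction exists on piecewise `C¹` functions. -/
lemma exists_isHelgasonDistribution {s : ℂ} (hs : s.re = 1 / 2) {C : ℝ} {f : ℂ → ℂ}
    (hf : IsBoundedEigenfunction s C f) :
    ∃ D : Module.Dual ℂ M.PiecewiseC1, M.IsHelgasonDistribution s f D := by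
  have hex : ∀ ψ : M.PiecewiseC1, ∃ l : ℂ,
      Tendsto (fun r : ℝ => helgasonIntegral s f (M.glue ψ) r) atTop (𝓝 l) := fun ψ => by
    choose l hl using fun k =>
      exists_tendsto_helgasonIntegral hs hf (M.isArcC1_component ψ.2 k)
    refine ⟨∑ k, l k, (tendsto_finsetSum Finset.univ fun k _ => hl k).congr fun r => ?_⟩
    rw [M.helgasonIntegral_glue s hf.contDiffOn ψ.2]
  choose d hd using hex
  refine ⟨{ toFun := d, map_add' := fun ψ φ => ?_, map_smul' := fun c ψ => ?_ }, hd⟩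
  · refine tendsto_nhds_unique (hd (ψ + φ)) (((hd ψ).add (hd φ)).congr fun r => ?_)
    exact (M.helgasonIntegral_glue_add s hf.contDiffOn ψ.2 φ.2 r).symm
  · refine tendsto_nhds_unique (hd (c • ψ)) (((hd ψ).const_mul c).congr fun r => ?_)
    exact (M.helgasonIntegral_glue_smul s f c ψ r).symm

/-! ### Branches of the Markov map -/

lemma mem_image_T_iff (k : Fin M.q) (ξ : Circle) : ξ ∈ M.T '' M.I k ↔ (M.γ k)⁻¹ • ξ ∈ M.I k := by
  constructor
  · rintro ⟨η, hη, rfl⟩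
    simpa [M.T_eq k η hη] using hη
  · intro h
    exact ⟨_, h, by rw [M.T_eq k _ h, smul_inv_smul]⟩

/-- The Markov property: an image `T (I k)` is a union of members of the partition, so meeting `I l`
means containing it. The condition in the transfer operator thereby becomes pointwise. -/
lemma subset_image_T_iff {k l : Fin M.q} {ξ : Circle} (hξ : ξ ∈ M.I l) :
    M.I l ⊆ M.T '' M.I k ↔ ξ ∈ M.T '' M.I k := by
  refine ⟨fun h => h hξ, fun h => ?_⟩
  obtain ⟨S, hS⟩ := M.markov k
  rw [hS] at h ⊢
  obtain ⟨l', hl', hξ'⟩ := mem_iUnion₂.mp h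
  have : l' = l := by
    by_contra hne
    exact (M.disjoint hne).le_bot ⟨hξ', hξ⟩
  subst this
  exact subset_biUnion_of_mem (u := M.I) hl'

lemma glue_apply (ψ : Fin M.q → Circle → ℂ) {l : Fin M.q} {ξ : Circle} (hξ : ξ ∈ M.I l) :
    M.glue ψ ξ = ψ l ξ := by
  unfold glue
  rw [Finset.sum_eq_single l, indicator_of_mem hξ]
  · exact fun k _ hk => indicator_of_notMem (fun h => (M.disjoint hk).le_bot ⟨h, hξ⟩) _
  · exact fun h => absurd (Finset.mem_univ l) h

/-- The transfer operator pushes the components of `ψ` forward by the branches of `T`. -/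
lemma glue_transferFun (s : ℂ) (ψ : Fin M.q → Circle → ℂ) :
    M.glue (M.transferFun s ψ)
      = fun ξ => ∑ k, pushDensity s (M.γ k) ((M.I k).indicator (ψ k)) ξ := by
  classical
  funext ξ
  obtain ⟨l, hl⟩ := mem_iUnion.mp (M.iUnion_eq ▸ mem_univ ξ : ξ ∈ ⋃ k, M.I k)
  rw [M.glue_apply _ hl, transferFun, Finset.sum_filter]
  refine Finset.sum_congr rfl fun k _ => ?_
  rw [pushDensity, indicator_apply]
  simp only [M.subset_image_T_iff hl, M.mem_image_T_iff]
  split_ifs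
  · rfl
  · rw [zero_div]

end MarkovMap

end Hyperbolic

end

/-! ### Invariance of the Helgason distribution under the dual transfer operator -/

theorem proposition2p6 (Γ : Subgroup Hyperbolic.SU11) (hΓ : Hyperbolic.IsCocompactFuchsian Γ)
    (t : ℝ) (s : ℂ) (hs : s = 1 / 2 + t * Complex.I)
    (f : ℂ → ℂ) (hf : Hyperbolic.IsAutomorphicEigenfunction Γ s f)
    (M : Hyperbolic.MarkovMap Γ) :
    ∃ D : Module.Dual ℂ M.PiecewiseC1,
      M.IsHelgasonDistribution s f D ∧ (M.transferOperator s).dualMap D = D := by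
  have hre : s.re = 1 / 2 := by simp [hs]
  obtain ⟨C, hfb⟩ := hf.exists_isBoundedEigenfunction hΓ
  obtain ⟨D, hD⟩ := M.exists_isHelgasonDistribution hre hfb
  refine ⟨D, hD, LinearMap.ext fun ψ => ?_⟩
  rw [LinearMap.dualMap_apply]
  have hlim : Tendsto (fun r : ℝ => Hyperbolic.helgasonIntegral s f (M.glue (M.transferOperator s ψ)) r
      - Hyperbolic.helgasonIntegral s f (M.glue ψ) r) atTop (𝓝 0) := by
    have h := tendsto_finsetSum Finset.univ fun k _ =>
      Hyperbolic.isEquivariant hre (M.γ k) C f hfb _ (M.isArcC1_component ψ.2 k)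
    rw [Finset.sum_const_zero] at h
    refine h.congr fun r => ?_
    have hglue : M.glue (M.transferOperator s ψ : Fin M.q → Circle → ℂ) = _ :=
      M.glue_transferFun s ψ
    rw [hglue, Hyperbolic.helgasonIntegral_sum hfb.contDiffOn Finset.univ
      (fun k _ => (M.isArcC1_component ψ.2 k).pushDensity s (M.γ k)),
      M.helgasonIntegral_glue s hfb.contDiffOn ψ.2, ← Finset.sum_sub_distrib]
    refine Finset.sum_congr rfl fun k _ => ?_
    -- Automorphy enters here: composing `f` with the inverse of `γ k` does not change it on the
    -- disk.
    rw [Hyperbolic.helgasonIntegral_congr s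
      (fun z hz => hf.automorphic _ (Γ.inv_mem (M.γ_mem k)) z hz)]
  exact sub_eq_zero.mp (tendsto_nhds_unique ((hD _).sub (hD ψ)) hlim)
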